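/- For $N\in\mathbb N$, $N\ge 1$, let $\mathfrak u(N)$ be the space of skew-Hermitian $N\times N$ matrices with the real inner product $\langle A,B\rangle_N=N\,\mathrm{tr}(AB^*)$, let $\Delta_N$ be the induced left-invariant Laplacian on the unitary group $\mathbb U(N)$, i.e. $\Delta_N f(A)=\sum_{\xi}\frac{d^2}{ds^2}\big|_{s=0}f(Ae^{s\xi})$ with the sum over an orthonormal basis of $\mathfrak u(N)$, and let Brownian motion on $\mathbb U(N)$ mean the Markov diffusion $(U^N_t)_{t\ge0}$ with continuous paths, issued from the identity, with generator $\frac12\Delta_N$. For $U\in\mathbb U(N)$ with eigenvalues $\lambda_1,\dots,\lambda_N$ (repeated according to multiplicity) let $\mu_U=\frac1N\sum_{j=1}^N\delta_{\lambda_j}$ be its spectral measure. For probability measures on $\mathbb S^1=\{z\in\mathbb C:|z|=1\}$ let $W_1(\mu,\nu)=\inf_\pi\int|x-y|\,d\pi(x,y)$, the infimum being over all couplings $\pi$ of $\mu$ and $\nu$. Let $\nu$ be the uniform probability measure on $\mathbb S^1$. There are (deterministic) probability measures $\nu_t$, $t>0$, on $\mathbb S^1$, Biane's limiting spectral measures,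 such that for every $t>0$ and all Brownian motions $U^N$ on $\mathbb U(N)$, $N\ge1$, defined on a common probability space, almost surely $\int f\,d\mu_{U^N_t}\to\int f\,d\nu_t$ as $N\to\infty$ for all $f\in C(\mathbb S^1)$; and there is a constant $C\in(0,\infty)$ such that for all $t\ge1$ $$W_1(\nu_t,\nu)\le C\,t^{3/2}e^{-t/4}.$$ -/

import Mathlib

open MeasureTheory ProbabilityTheory Filter Topology
open scoped NNReal ENNReal

universe u

/-! ### Measures on the unit circle -/

/-- The unit circle in `ℂ` carries its Borel `σ`-algebra. -/
noncomputable instance Circle.instMeasurableSpaceBorel : MeasurableSpace Circle := borel Circle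

instance Circle.instBorelSpaceBorel : BorelSpace Circle := ⟨rfl⟩

/-- The `L₁`-Wasserstein distance: the infimum of `∫ |x - y| dπ(x, y)` over all couplings `π` of
`μ` and `ν`, as an element of `[0, ∞]`. On `Circle` the distance is `|x - y|` in `ℂ`. -/
noncomputable def wasserstein1 {X : Type*} [MetricSpace X] [MeasurableSpace X]
    (μ ν : Measure X) : ℝ≥0∞ :=
  ⨅ (π : Measure (X × X)) (_ : π.map Prod.fst = μ ∧ π.map Prod.snd = ν),
    ∫⁻ p, edist p.1 p.2 ∂π

/-- The uniform probability measure on the unit circle: the law of `e^{iθ}` where `θ` is uniformly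
distributed on `(0, 2π]`. -/
noncomputable def uniformCircle : Measure Circle :=
  ((ENNReal.ofReal (2 * Real.pi))⁻¹ • volume.restrict (Set.Ioc 0 (2 * Real.pi))).map Circle.exp

/-- The spectral measure `(1 / N) ∑ⱼ δ_{λⱼ}` of a unitary `N × N` matrix, where `λ₁, …, λ_N` are
its eigenvalues, repeated according to multiplicity. The sum is formed in `ℂ` and then viewed as a
measure on the unit circle, which contains all the `λⱼ`. -/
noncomputable def spectralMeasure {N : ℕ} (V : Matrix.unitaryGroup (Fin N) ℂ) : Measure Circle :=
  ((N : ℝ≥0∞)⁻¹ • ((V : Matrix (Fin N) (Fin N) ℂ).charpoly.roots.map Measure.dirac).sum).comap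
    (fun z : Circle => (z : ℂ))

/-! ### Brownian motion on the unitary group -/

/-- The standard orthonormal basis of the Lie algebra `𝔲(N)` of skew-Hermitian matrices for the
real inner product `⟨A, B⟩ = N * tr (A Bᴴ)`: the matrices `i E_{jj} / √N`,
`(E_{jk} - E_{kj}) / √(2N)` and `i (E_{jk} + E_{kj}) / √(2N)`, for `j < k`. -/
noncomputable def skewBasis (N : ℕ) (j k : Fin N) : Matrix (Fin N) (Fin N) ℂ :=
  if j = k then (Complex.I / (√(N : ℝ) : ℂ)) • Matrix.single j j 1
  else if j < k then
    (1 / (√(2 * N : ℝ) : ℂ)) • (Matrix.single j k 1 - Matrix.single k j 1)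
  else (Complex.I / (√(2 * N : ℝ) : ℂ)) • (Matrix.single j k 1 + Matrix.single k j 1)

/-- The left-invariant Laplacian `Δ_N f (A) = ∑_ξ (d/ds)²|_{s = 0} f (A e^{s ξ})` on the unitary
group, the sum being over an orthonormal basis of `𝔲(N)`. It depends only on the restriction of `f`
to the unitary group if `A` is unitary. -/
noncomputable def unitaryLaplacian (N : ℕ) (f : (Fin N → Fin N → ℂ) → ℝ)
    (A : Matrix (Fin N) (Fin N) ℂ) : ℝ :=
  ∑ j, ∑ k, iteratedDeriv 2
    (fun s : ℝ => f (Matrix.of.symm (A * NormedSpace.exp (s • skewBasis N j k)))) 0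

/-- `U` is a Brownian motion on the unitary group `𝕌(N)`: the diffusion issued from the identity
with generator `Δ_N / 2`, that is, the process with continuous paths started at the identity that
solves the martingale problem for this generator. The test functions are the smooth functions on
the space of matrices; their restrictions to the compact submanifold `𝕌(N)` are exactly its smooth
functions. -/
structure IsUnitaryBrownianMotion {Ω : Type*} [mΩ : MeasurableSpace Ω] (N : ℕ)
    (U : ℝ≥0 → Ω → Matrix.unitaryGroup (Fin N) ℂ) (P : Measure Ω) : Prop where
  start : ∀ᵐ ω ∂P, U 0 ω = 1
  continuous_paths : ∀ᵐ ω ∂P, Continuous fun t => U t ω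
  martingale_problem : ∃ ℱ : Filtration ℝ≥0 mΩ, StronglyAdapted ℱ U ∧
    ∀ f : (Fin N → Fin N → ℂ) → ℝ, ContDiff ℝ (⊤ : ℕ∞) f →
      Martingale (fun t ω => f (Matrix.of.symm (U t ω : Matrix (Fin N) (Fin N) ℂ)) -
        ∫ s in (0 : ℝ)..t, (1 / 2) * unitaryLaplacian N f (U s.toNNReal ω)) ℱ P

/-- `ν` is the (deterministic) limiting spectral measure of unitary Brownian motion at time `t`:
whenever for each `N ≥ 1` a Brownian motion `U N` on `𝕌(N)` is given, all on one probability space,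
almost surely the spectral measures of `U N t` converge weakly to `ν` as `N → ∞`. -/
structure IsLimitingSpectralMeasure (t : ℝ≥0) (ν : Measure Circle) : Prop where
  isProbabilityMeasure : IsProbabilityMeasure ν
  tendsto : ∀ (Ω : Type u) [MeasurableSpace Ω] (P : Measure Ω) [IsProbabilityMeasure P]
    (U : (N : ℕ) → ℝ≥0 → Ω → Matrix.unitaryGroup (Fin N) ℂ),
    (∀ N, 1 ≤ N → IsUnitaryBrownianMotion N (U N) P) →
    ∀ᵐ ω ∂P, ∀ f : C(Circle, ℝ),
      Tendsto (fun N => ∫ z, f z ∂spectralMeasure (U N t ω)) atTop (𝓝 (∫ z, f z ∂ν))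

/-!
The limiting spectral measures are found through their moments, and the two halves of the theorem
use two descriptions of the same numbers `mₙ(t)`.

*Dynamics.* Let `Xₙ = tr (Uⁿ) / N`. The identity `∑_ξ ξ B ξ = -(tr B / N) 1` shows that `Δ_N / 2`
maps `Xₙ` to `-(n / 2) ∑_{i < n} Xᵢ₊₁ Xₙ₋₁₋ᵢ`, while the carré du champ of `Xₙ` is `O(1 / N²)`. So
in the limit the moments must solve `mₙ' = -(n / 2) ∑_{i < n} mᵢ₊₁ mₙ₋₁₋ᵢ` with `mₙ(0) = 1`; the
solution is `e^{-nt/2}` times a polynomial (`bianePoly`, `bianeMoment`). Dynkin's formula for `Re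
Xₙ` and `|Xₙ|²` gives a differential inequality for `E |Xₙ - mₙ|²` in terms of the same quantities
with smaller index, hence `E |Xₙ - mₙ|² = O(1 / N²)` (`exists_integral_sq_le`). This is summable
in `N`, so `Xₙ → mₙ` almost surely for any coupling of the different `N`, and the moments
determine weak convergence on the circle (`tendsto_integral_of_tendsto_moments`).

*Existence and the distance to uniform.* The generating function `P` of the `bianePoly` solves a
Burgers equation, whose integrated form along characteristics is `bianePoly_series_functional_eq`.
Analytically, `M = ∑_{n ≥ 1} mₙ zⁿ = ω / (1 - ω)`, where `ω(z)` is the fixed point of `w ↦ z exp (-(t / 2)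
(1 + w) / (1 - w))` in the unit disc. The iterates `ω_k` of this map already have the right Taylor
coefficients up to order `k` (`coeff_taylorAtZero_momentApprox`), and they stay in the disc, so
that `(1 + ω_k) / (1 - ω_k)` has nonnegative real part; by the Herglotz theorem
(`exists_measure_of_tendsto_taylor`) the `mₙ(t)` are the moments of a probability measure. For
large `t` the map preserves the disc of radius `e^{-t/4}`, so the real part is at least `1 - 3
e^{-t/4}`. Thus the limiting measure is a mixture of the uniform measure with weight `1 - 3
e^{-t/4}` and some other probability measure, and an explicit coupling yields `W₁ ≤ 6 e^{-t/4}`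
(`exists_measure_bianeMoment`), which for `t ≥ 1` is stronger than the bound claimed.
-/

/-! ### The limiting moments as formal power series -/

/-- The antiderivative of a polynomial which vanishes at `0`. -/
noncomputable def polyPrimitive (q : Polynomial ℝ) : Polynomial ℝ :=
  ∑ k ∈ q.support, Polynomial.C (q.coeff k / (k + 1)) * Polynomial.X ^ (k + 1)

lemma derivative_polyPrimitive (q : Polynomial ℝ) :
    Polynomial.derivative (polyPrimitive q) = q := by
  rw [polyPrimitive, Polynomial.derivative_sum]
  conv_rhs => rw [q.as_sum_support_C_mul_X_pow]
  refine Finset.sum_congr rfl fun k _ => ?_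
  rw [Polynomial.derivative_C_mul_X_pow]
  have : ((k : ℝ) + 1) ≠ 0 := by positivity
  push_cast
  rw [div_mul_cancel₀ _ this]

lemma polyPrimitive_eval_zero (q : Polynomial ℝ) : (polyPrimitive q).eval 0 = 0 := by
  simp [polyPrimitive, Polynomial.eval_finsetSum]

/-- The polynomials `pₙ` with `pₙ(0) = 1` and `pₙ' = -(n / 2) ∑_{0 < k < n} pₖ pₙ₋ₖ`, such that
`e^{-nt/2} pₙ(t)` is the `n`-th moment of the limiting spectral measure at time `t`. The value
`p₀ = 0` makes the generating function start in degree one. -/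
noncomputable def bianePoly : ℕ → Polynomial ℝ
  | 0 => 0
  | n + 1 => 1 - Polynomial.C (((n : ℝ) + 1) / 2) *
      polyPrimitive (∑ i : Fin n, bianePoly (i + 1) * bianePoly (n - i))
  decreasing_by all_goals omega

lemma bianePoly_zero : bianePoly 0 = 0 := by rw [bianePoly]

lemma bianePoly_eval_zero {n : ℕ} (hn : n ≠ 0) : (bianePoly n).eval 0 = 1 := by
  obtain ⟨n, rfl⟩ := Nat.exists_eq_succ_of_ne_zero hn
  rw [Nat.succ_eq_add_one, bianePoly]
  simp [polyPrimitive_eval_zero]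

lemma derivative_bianePoly (n : ℕ) :
    Polynomial.derivative (bianePoly n) = -(Polynomial.C ((n : ℝ) / 2) *
      ∑ x ∈ Finset.HasAntidiagonal.antidiagonal n, bianePoly x.1 * bianePoly x.2) := by
  rcases n with _ | n
  · simp [bianePoly_zero]
  · rw [bianePoly, Finset.Nat.sum_antidiagonal_eq_sum_range_succ_mk, Finset.sum_range_succ,
      Finset.sum_range_succ', Fin.sum_univ_eq_sum_range
        (fun i => bianePoly (i + 1) * bianePoly (n - i))]
    simp [bianePoly_zero, derivative_polyPrimitive]

lemma bianePoly_one : bianePoly 1 = 1 := by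
  rw [bianePoly]
  simp [polyPrimitive]

namespace PowerSeries

/-- The Euler operator `D = y ∂/∂y`, acting on a power series by multiplying the `n`-th
coefficient by `n`. -/
noncomputable def euler {R : Type*} [CommRing R] (f : PowerSeries R) : PowerSeries R :=
  mk fun n => (n : R) * coeff n f

/-- The derivative of a power series with polynomial coefficients with respect to the variable of
the coefficients. -/
noncomputable def coeffDeriv (f : PowerSeries (Polynomial ℝ)) : PowerSeries (Polynomial ℝ) :=
  mk fun n => Polynomial.derivative (coeff n f)

@[simp] lemma coeff_euler {R : Type*} [CommRing R] (n : ℕ) (f : PowerSeries R) :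
    coeff n (euler f) = (n : R) * coeff n f := coeff_mk _ _

@[simp] lemma coeff_coeffDeriv (n : ℕ) (f : PowerSeries (Polynomial ℝ)) :
    coeff n (coeffDeriv f) = Polynomial.derivative (coeff n f) := coeff_mk _ _

lemma euler_add {R : Type*} [CommRing R] (f g : PowerSeries R) :
    euler (f + g) = euler f + euler g := by
  ext n; simp [mul_add]

lemma euler_mul {R : Type*} [CommRing R] (f g : PowerSeries R) :
    euler (f * g) = euler f * g + f * euler g := by
  ext n
  simp only [coeff_euler, coeff_mul, map_add, Finset.mul_sum, ← Finset.sum_add_distrib]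
  refine Finset.sum_congr rfl fun x hx => ?_
  rw [← Finset.HasAntidiagonal.mem_antidiagonal.1 hx]
  push_cast
  ring

lemma euler_C {R : Type*} [CommRing R] (a : R) : euler (C a) = 0 := by
  ext n
  rcases n with _ | n <;> simp [coeff_C]

lemma coeffDeriv_add (f g : PowerSeries (Polynomial ℝ)) :
    coeffDeriv (f + g) = coeffDeriv f + coeffDeriv g := by
  ext1 n; simp

lemma coeffDeriv_neg (f : PowerSeries (Polynomial ℝ)) : coeffDeriv (-f) = -coeffDeriv f := by
  ext1 n; simp

lemma coeffDeriv_mul (f g : PowerSeries (Polynomial ℝ)) :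
    coeffDeriv (f * g) = coeffDeriv f * g + f * coeffDeriv g := by
  ext1 n
  simp only [coeff_coeffDeriv, coeff_mul, map_add, Polynomial.derivative_sum,
    Polynomial.derivative_mul, ← Finset.sum_add_distrib]

lemma coeffDeriv_C_X : coeffDeriv (C Polynomial.X) = 1 := by
  ext1 n
  rcases n with _ | n <;> simp [coeff_C, coeff_one]

lemma coeffDeriv_euler (f : PowerSeries (Polynomial ℝ)) :
    coeffDeriv (euler f) = euler (coeffDeriv f) := by
  ext1 n
  simp [Polynomial.derivative_mul]

end PowerSeries

open PowerSeries in
/-- The generating function `P` of the polynomials `pₙ` satisfies the Burgers equation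
`∂P/∂t = -P · y ∂P/∂y`. -/
lemma coeffDeriv_bianePoly_series :
    coeffDeriv (mk bianePoly) = -(mk bianePoly * euler (mk bianePoly)) := by
  have h : (2 : PowerSeries (Polynomial ℝ)) * (mk bianePoly * euler (mk bianePoly)) =
      euler (mk bianePoly * mk bianePoly) := by
    rw [euler_mul]; ring
  have h2 : (2 : PowerSeries (Polynomial ℝ)) * coeffDeriv (mk bianePoly) =
      -euler (mk bianePoly * mk bianePoly) := by
    ext1 n
    have e : (2 : PowerSeries (Polynomial ℝ)) = C (Polynomial.C 2) := by
      rw [map_ofNat, map_ofNat]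
    rw [e, coeff_C_mul, coeff_coeffDeriv, coeff_mk, derivative_bianePoly, map_neg, coeff_euler,
      coeff_mul]
    simp only [coeff_mk]
    rw [mul_neg, ← mul_assoc, ← Polynomial.C_mul]
    congr 2
    rw [← map_natCast Polynomial.C]
    congr 1
    ring
  have h3 : (2 : PowerSeries (Polynomial ℝ)) ≠ 0 := by
    intro h0
    have := congrArg (coeff 0) h0
    have e : (2 : PowerSeries (Polynomial ℝ)) = C (Polynomial.C 2) := by
      rw [map_ofNat, map_ofNat]
    rw [e] at this
    simp at this
  refine mul_left_cancel₀ h3 ?_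
  rw [h2, mul_neg, h]

open PowerSeries in
/-- Integrated form of the Burgers equation along its characteristics: with `Q = P + P²`,
`y ∂P/∂y · (1 + t Q) = Q`. The difference `K` of the two sides satisfies the linear equation
`∂K/∂t = -y ∂(PK)/∂y` with initial value `0`, and since `P` has no constant term this equation
determines the coefficients of `K` one after the other. -/
lemma bianePoly_series_functional_eq :
    euler (mk bianePoly) * (1 + C Polynomial.X * (mk bianePoly + mk bianePoly * mk bianePoly)) =
      mk bianePoly + mk bianePoly * mk bianePoly := by
  set P := mk bianePoly with hP
  set T : PowerSeries (Polynomial ℝ) := C Polynomial.X with hT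
  set K := euler P * (1 + T * (P + P * P)) + -(P + P * P) with hK
  have hPd : coeffDeriv P = -(P * euler P) := coeffDeriv_bianePoly_series
  have h1 : (1 : PowerSeries (Polynomial ℝ)) = C 1 := by simp
  have hKd : coeffDeriv K = -euler (P * K) := by
    have hneg : euler (-(P + P * P)) = -euler (P + P * P) := by ext1 n; simp only [coeff_euler, map_neg, mul_neg]
    have e1 : coeffDeriv (1 : PowerSeries (Polynomial ℝ)) = 0 := by
      ext1 n; rcases n with _ | n <;> simp [coeff_one]
    have e2 : euler (1 : PowerSeries (Polynomial ℝ)) = 0 := by rw [h1, euler_C]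
    have e3 : euler T = 0 := euler_C _
    have e4 : coeffDeriv T = 1 := coeffDeriv_C_X
    have e5 : euler (-(P * euler P)) = -euler (P * euler P) := by ext1 n; simp
    rw [euler_mul, hK]
    simp only [coeffDeriv_add, coeffDeriv_mul, coeffDeriv_neg, coeffDeriv_euler, hPd, e5, hneg,
      euler_add, euler_mul, e1, e2, e3, e4]
    ring
  have hcoeff : ∀ n, coeff n K = 0 := by
    intro n
    induction n using Nat.strong_induction_on with
    | _ n ih =>
      have hd : Polynomial.derivative (coeff n K) = 0 := by
        rw [← coeff_coeffDeriv, hKd, map_neg, coeff_euler, coeff_mul, Finset.sum_eq_zero]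
        · simp
        · intro x hx
          have hx' := Finset.HasAntidiagonal.mem_antidiagonal.1 hx
          by_cases h0 : x.1 = 0
          · rw [h0, hP, coeff_mk, bianePoly_zero, zero_mul]
          · rw [ih x.2 (by omega), mul_zero]
      have hc := Polynomial.derivative_eq_zero.1 hd
      rw [Polynomial.eq_C_of_natDegree_eq_zero hc, Polynomial.coeff_zero_eq_eval_zero]
      have hev : ∀ m, (bianePoly m).eval 0 = if m = 0 then 0 else 1 := by
        intro m
        split_ifs with hm
        · simp [hm, bianePoly_zero]
        · exact bianePoly_eval_zero hm
      -- at `t = 0` the generating function is `y / (1 - y)`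
      have hPP : Polynomial.eval 0 (coeff n (P * P)) = (n : ℝ) - if n = 0 then 0 else 1 := by
        rw [coeff_mul, Polynomial.eval_finsetSum]
        simp only [hP, coeff_mk, Polynomial.eval_mul, hev]
        rcases n with _ | n
        · simp
        · rw [Finset.Nat.sum_antidiagonal_eq_sum_range_succ_mk, Finset.sum_range_succ,
            Finset.sum_range_succ']
          rw [Finset.sum_congr rfl (g := fun _ => (1 : ℝ))]
          · simp
          · intro i hi
            have := Finset.mem_range.1 hi
            rw [if_neg (by omega), if_neg (by omega), one_mul]
      have : Polynomial.eval 0 (coeff n K) = 0 := by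
        have hexp : K = euler P + T * (euler P * (P + P * P)) - P - P * P := by rw [hK]; ring
        rw [hexp]
        simp only [map_add, map_sub, hT, coeff_C_mul, Polynomial.eval_add, Polynomial.eval_sub,
          Polynomial.eval_mul, Polynomial.eval_X, hPP, coeff_euler, Polynomial.eval_natCast,
          zero_mul]
        simp only [hP, coeff_mk, hev]
        split_ifs with h <;> simp [h]
      rw [this, map_zero]
  have hK0 : K = 0 := by ext1 n; simpa using hcoeff n
  rw [hK] at hK0
  linear_combination hK0

/-- The `n`-th moment of the limiting spectral measure at time `t`, for `n ≥ 1`; the value at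
`n = 0` is `0`. -/
noncomputable def bianeMoment (t : ℝ) (n : ℕ) : ℝ :=
  Real.exp (-(t / 2)) ^ n * (bianePoly n).eval t

lemma bianeMoment_zero_right (t : ℝ) : bianeMoment t 0 = 0 := by
  simp [bianeMoment, bianePoly_zero]

lemma bianeMoment_one (t : ℝ) : bianeMoment t 1 = Real.exp (-(t / 2)) := by
  simp [bianeMoment, bianePoly_one]

lemma bianeMoment_zero_left {n : ℕ} (hn : n ≠ 0) : bianeMoment 0 n = 1 := by
  simp [bianeMoment, bianePoly_eval_zero hn]

/-- The moments satisfy `mₙ' = -(n / 2) (mₙ + ∑_{0 < k < n} mₖ mₙ₋ₖ)`. -/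
lemma hasDerivAt_bianeMoment (n : ℕ) (t : ℝ) :
    HasDerivAt (fun s => bianeMoment s n) (-((n : ℝ) / 2) * (bianeMoment t n +
      ∑ x ∈ Finset.HasAntidiagonal.antidiagonal n, bianeMoment t x.1 * bianeMoment t x.2)) t := by
  have h1 : HasDerivAt (fun s : ℝ => Real.exp (-(s / 2)) ^ n)
      (-((n : ℝ) / 2) * Real.exp (-(t / 2)) ^ n) t := by
    have h : HasDerivAt (fun s : ℝ => Real.exp (-((n : ℝ) / 2) * s))
        (Real.exp (-((n : ℝ) / 2) * t) * (-((n : ℝ) / 2) * 1)) t :=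
      ((hasDerivAt_id t).const_mul _).exp
    have e : ∀ s : ℝ, Real.exp (-(s / 2)) ^ n = Real.exp (-((n : ℝ) / 2) * s) := fun s => by
      rw [← Real.exp_nat_mul]; congr 1; ring
    simp only [e]
    convert h using 1
    ring
  refine (h1.mul ((bianePoly n).hasDerivAt t)).congr_deriv ?_
  have hs : ∑ x ∈ Finset.HasAntidiagonal.antidiagonal n, bianeMoment t x.1 * bianeMoment t x.2 =
      Real.exp (-(t / 2)) ^ n * ∑ x ∈ Finset.HasAntidiagonal.antidiagonal n,
        (bianePoly x.1).eval t * (bianePoly x.2).eval t := by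
    rw [Finset.mul_sum]
    refine Finset.sum_congr rfl fun x hx => ?_
    rw [← Finset.HasAntidiagonal.mem_antidiagonal.1 hx, bianeMoment, bianeMoment, pow_add]
    ring
  rw [hs, derivative_bianePoly]
  simp only [bianeMoment, Polynomial.eval_neg, Polynomial.eval_mul, Polynomial.eval_C,
    Polynomial.eval_finsetSum]
  ring

/-- The generating function of the moments, with complex coefficients. -/
noncomputable def bianeSeries (t : ℝ) : PowerSeries ℂ :=
  PowerSeries.mk fun n => (bianeMoment t n : ℂ)

open PowerSeries in
lemma bianeSeries_functional_eq (t : ℝ) :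
    euler (bianeSeries t) = (bianeSeries t + bianeSeries t * bianeSeries t) *
      (1 - C (t : ℂ) * euler (bianeSeries t)) := by
  -- substitute `e^{-t/2} z` for `y` and the value `t` for the variable of the coefficients
  let φ : PowerSeries (Polynomial ℝ) →+* PowerSeries ℂ :=
    (rescale ((Real.exp (-(t / 2)) : ℝ) : ℂ)).comp
      (PowerSeries.map ((algebraMap ℝ ℂ).comp (Polynomial.evalRingHom t)))
  have hφ : ∀ n f, coeff n (φ f) =
      ((Real.exp (-(t / 2)) : ℝ) : ℂ) ^ n * (((coeff n f).eval t : ℝ) : ℂ) := by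
    intro n f
    simp [φ, coeff_rescale]
  have h1 : φ (mk bianePoly) = bianeSeries t := by
    ext n
    rw [hφ]
    simp [bianeSeries, bianeMoment]
  have h2 : ∀ f, φ (euler f) = euler (φ f) := by
    intro f
    ext n
    simp only [hφ, coeff_euler]
    simp
    ring
  have h3 : φ (C Polynomial.X) = C (t : ℂ) := by
    ext n
    rw [hφ]
    rcases n with _ | n <;> simp [coeff_C]
  have h := congrArg φ bianePoly_series_functional_eq
  simp only [map_mul, map_add, map_one, h1, h2, h3] at h
  linear_combination h

/-! ### Holomorphic functions on the disc with the limiting moments as Taylor coefficients -/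

/-- The Taylor series at `0` of a function on `ℂ`. -/
noncomputable def taylorAtZero (f : ℂ → ℂ) : PowerSeries ℂ :=
  PowerSeries.mk fun n => iteratedDeriv n f 0 / (n.factorial : ℂ)

lemma coeff_taylorAtZero (f : ℂ → ℂ) (n : ℕ) :
    PowerSeries.coeff n (taylorAtZero f) = iteratedDeriv n f 0 / (n.factorial : ℂ) :=
  PowerSeries.coeff_mk _ _

lemma taylorAtZero_congr {f g : ℂ → ℂ} (h : f =ᶠ[𝓝 0] g) : taylorAtZero f = taylorAtZero g := by
  ext n
  rw [coeff_taylorAtZero, coeff_taylorAtZero, h.iteratedDeriv_eq]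

lemma taylorAtZero_add {f g : ℂ → ℂ} (hf : AnalyticAt ℂ f 0) (hg : AnalyticAt ℂ g 0) :
    taylorAtZero (f + g) = taylorAtZero f + taylorAtZero g := by
  ext n
  rw [map_add]
  simp only [coeff_taylorAtZero]
  rw [iteratedDeriv_add hf.contDiffAt hg.contDiffAt, add_div]

lemma taylorAtZero_sub {f g : ℂ → ℂ} (hf : AnalyticAt ℂ f 0) (hg : AnalyticAt ℂ g 0) :
    taylorAtZero (f - g) = taylorAtZero f - taylorAtZero g := by
  ext n
  rw [map_sub]
  simp only [coeff_taylorAtZero]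
  rw [iteratedDeriv_sub hf.contDiffAt hg.contDiffAt, sub_div]

lemma taylorAtZero_mul {f g : ℂ → ℂ} (hf : AnalyticAt ℂ f 0) (hg : AnalyticAt ℂ g 0) :
    taylorAtZero (f * g) = taylorAtZero f * taylorAtZero g := by
  ext n
  rw [PowerSeries.coeff_mul, Finset.Nat.sum_antidiagonal_eq_sum_range_succ_mk]
  simp only [coeff_taylorAtZero]
  rw [iteratedDeriv_mul hf.contDiffAt hg.contDiffAt, Finset.sum_div]
  refine Finset.sum_congr rfl fun i hi => ?_
  have hi' : i ≤ n := by have := Finset.mem_range.1 hi; omega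
  have h := Nat.choose_mul_factorial_mul_factorial hi'
  have h' : ((n.choose i : ℕ) : ℂ) * (i.factorial : ℂ) * ((n - i).factorial : ℂ) =
      (n.factorial : ℂ) := by exact_mod_cast h
  have h1 : (i.factorial : ℂ) ≠ 0 := by exact_mod_cast i.factorial_ne_zero
  have h2 : ((n - i).factorial : ℂ) ≠ 0 := by exact_mod_cast (n - i).factorial_ne_zero
  have h3 : (n.factorial : ℂ) ≠ 0 := by exact_mod_cast n.factorial_ne_zero
  rw [div_mul_div_comm, div_eq_div_iff h3 (mul_ne_zero h1 h2), ← h']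
  ring

lemma taylorAtZero_const (c : ℂ) : taylorAtZero (fun _ => c) = PowerSeries.C c := by
  ext n
  rw [coeff_taylorAtZero, PowerSeries.coeff_C, iteratedDeriv_const]
  split_ifs with h
  · simp [h]
  · simp

lemma taylorAtZero_id_mul_deriv {f : ℂ → ℂ} (hf : AnalyticAt ℂ f 0) :
    taylorAtZero (fun z => z * deriv f z) = PowerSeries.euler (taylorAtZero f) := by
  have h : (fun z => z * deriv f z) = (fun z : ℂ => z) * deriv f := rfl
  rw [h, taylorAtZero_mul (f := fun z => z) analyticAt_id hf.deriv]
  have hX : taylorAtZero (fun z : ℂ => z) = PowerSeries.X := by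
    ext n
    rw [coeff_taylorAtZero, PowerSeries.coeff_X, iteratedDeriv_fun_id_zero]
    split_ifs with h
    · simp [h]
    · simp
  rw [hX]
  ext n
  rcases n with _ | n
  · simp
  · rw [PowerSeries.coeff_succ_X_mul, PowerSeries.coeff_euler, coeff_taylorAtZero,
      coeff_taylorAtZero, ← iteratedDeriv_succ', Nat.factorial_succ]
    have h1 : (n.factorial : ℂ) ≠ 0 := by exact_mod_cast n.factorial_ne_zero
    have h2 : ((n : ℂ) + 1) ≠ 0 := by exact_mod_cast n.succ_ne_zero
    push_cast
    field_simp

/-- Successive approximation for the equation `D f = (f + f²) (1 - t D f)`: if `b` is a solution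
and `g` agrees with `b` up to degree `k`, then a series `f` with `D f = (f + f²) (1 - t D g)` and
the same leading term as `b` agrees with `b` up to degree `k + 1`. -/
lemma coeff_eq_of_euler_eq {b f g : PowerSeries ℂ} {t : ℂ} {k : ℕ}
    (hb : PowerSeries.euler b = (b + b * b) * (1 - PowerSeries.C t * PowerSeries.euler b))
    (hf : PowerSeries.euler f = (f + f * f) * (1 - PowerSeries.C t * PowerSeries.euler g))
    (hb0 : PowerSeries.coeff 0 b = 0) (hf0 : PowerSeries.coeff 0 f = 0)
    (h1 : PowerSeries.coeff 1 f = PowerSeries.coeff 1 b)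
    (hg : ∀ n ≤ k, PowerSeries.coeff n g = PowerSeries.coeff n b) {n : ℕ} (hn : n ≤ k + 1) :
    PowerSeries.coeff n f = PowerSeries.coeff n b := by
  induction n using Nat.strong_induction_on with
  | _ n ih =>
    rcases Nat.lt_or_ge n 2 with hn2 | hn2
    · interval_cases n
      · rw [hb0, hf0]
      · exact h1
    have hsq : ∀ m ≤ n, PowerSeries.coeff m (f * f) = PowerSeries.coeff m (b * b) := by
      intro m hm
      rw [PowerSeries.coeff_mul, PowerSeries.coeff_mul]
      refine Finset.sum_congr rfl fun x hx => ?_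
      have hx' := Finset.HasAntidiagonal.mem_antidiagonal.1 hx
      by_cases hx1 : x.1 = 0
      · rw [hx1, hb0, hf0, zero_mul, zero_mul]
      by_cases hx2 : x.2 = 0
      · rw [hx2, hb0, hf0, mul_zero, mul_zero]
      rw [ih x.1 (by omega) (by omega), ih x.2 (by omega) (by omega)]
    have hprod : PowerSeries.coeff n ((f + f * f) * (PowerSeries.C t * PowerSeries.euler g)) =
        PowerSeries.coeff n ((b + b * b) * (PowerSeries.C t * PowerSeries.euler b)) := by
      rw [PowerSeries.coeff_mul, PowerSeries.coeff_mul]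
      refine Finset.sum_congr rfl fun x hx => ?_
      have hx' := Finset.HasAntidiagonal.mem_antidiagonal.1 hx
      rw [PowerSeries.coeff_C_mul, PowerSeries.coeff_C_mul, PowerSeries.coeff_euler,
        PowerSeries.coeff_euler, map_add, map_add, hsq x.1 (by omega)]
      by_cases hx1 : x.1 = 0
      · rw [hx1, hb0, hf0]
        simp [PowerSeries.coeff_mul, hb0]
      by_cases hx2 : x.2 = 0
      · simp [hx2]
      rw [ih x.1 (by omega) (by omega), hg x.2 (by omega)]
    have ef := congrArg (PowerSeries.coeff n) hf
    have eb := congrArg (PowerSeries.coeff n) hb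
    rw [mul_sub, mul_one, map_sub, map_add, PowerSeries.coeff_euler] at ef eb
    rw [hprod, hsq n le_rfl] at ef
    have hn1 : ((n : ℂ) - 1) ≠ 0 := by
      intro h
      have : (n : ℂ) = ((1 : ℕ) : ℂ) := by push_cast; linear_combination h
      have := Nat.cast_injective this
      omega
    refine mul_left_cancel₀ hn1 ?_
    linear_combination ef - eb

/-- Iterates of the self-map `w ↦ z exp (-(t / 2) (1 + w) / (1 - w))` of the unit disc. Their limit
is the subordination function of the limiting spectral measure at time `t`. -/
noncomputable def subordIter (t : ℝ) : ℕ → ℂ → ℂ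
  | 0 => fun _ => 0
  | k + 1 => fun z => z * Complex.exp (-((t : ℂ) / 2) *
      ((1 + subordIter t k z) / (1 - subordIter t k z)))

/-- The function `ω / (1 - ω)` for `ω` an iterate `subordIter t k`; it approximates the generating
function of the moments. -/
noncomputable def momentApprox (t : ℝ) (k : ℕ) (z : ℂ) : ℂ :=
  subordIter t k z / (1 - subordIter t k z)

lemma one_sub_div_one_add_le_re {w : ℂ} (hw : ‖w‖ < 1) :
    (1 - ‖w‖) / (1 + ‖w‖) ≤ ((1 + w) / (1 - w)).re := by
  have h1 : 1 - w ≠ 0 := by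
    intro h
    have : w = 1 := by linear_combination -h
    rw [this] at hw
    simp at hw
  have hpos : 0 < Complex.normSq (1 - w) := Complex.normSq_pos.2 h1
  have hre : ((1 + w) / (1 - w)).re = (1 - ‖w‖ ^ 2) / Complex.normSq (1 - w) := by
    rw [Complex.div_re, ← add_div, Complex.sq_norm]
    congr 1
    simp [Complex.normSq_apply]
    ring
  rw [hre, div_le_div_iff₀ (by positivity) hpos]
  have h2 : Complex.normSq (1 - w) ≤ (1 + ‖w‖) ^ 2 := by
    rw [← Complex.sq_norm]
    have : ‖1 - w‖ ≤ 1 + ‖w‖ := by simpa using norm_sub_le (1 : ℂ) w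
    gcongr
  have h3 : 0 ≤ 1 - ‖w‖ := by linarith
  calc (1 - ‖w‖) * Complex.normSq (1 - w) ≤ (1 - ‖w‖) * (1 + ‖w‖) ^ 2 := by gcongr
    _ = (1 - ‖w‖ ^ 2) * (1 + ‖w‖) := by ring

lemma norm_subordIter_succ (t : ℝ) (k : ℕ) (z : ℂ) :
    ‖subordIter t (k + 1) z‖ = ‖z‖ * Real.exp (-(t / 2) *
      ((1 + subordIter t k z) / (1 - subordIter t k z)).re) := by
  rw [subordIter, norm_mul, Complex.norm_exp]
  have : (-((t : ℂ) / 2)) = ((-(t / 2) : ℝ) : ℂ) := by push_cast; ring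
  rw [this, Complex.re_ofReal_mul]

lemma norm_subordIter_le {t : ℝ} (ht : 0 ≤ t) (k : ℕ) {z : ℂ} (hz : ‖z‖ < 1) :
    ‖subordIter t k z‖ ≤ ‖z‖ := by
  induction k with
  | zero => simp [subordIter]
  | succ k ih =>
    rw [norm_subordIter_succ]
    have hw : ‖subordIter t k z‖ < 1 := ih.trans_lt hz
    have h0 : 0 ≤ ((1 + subordIter t k z) / (1 - subordIter t k z)).re :=
      (div_nonneg (by linarith) (by positivity)).trans (one_sub_div_one_add_le_re hw)
    refine mul_le_of_le_one_right (norm_nonneg _) (Real.exp_le_one_iff.2 ?_)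
    nlinarith

lemma norm_subordIter_lt_one {t : ℝ} (ht : 0 ≤ t) (k : ℕ) {z : ℂ} (hz : ‖z‖ < 1) :
    ‖subordIter t k z‖ < 1 := (norm_subordIter_le ht k hz).trans_lt hz

lemma one_sub_subordIter_ne_zero {t : ℝ} (ht : 0 ≤ t) (k : ℕ) {z : ℂ} (hz : ‖z‖ < 1) :
    1 - subordIter t k z ≠ 0 := by
  intro h
  have h1 : subordIter t k z = 1 := by linear_combination -h
  have := norm_subordIter_lt_one ht k hz
  rw [h1] at this
  simp at this

/-- For large `t` the iterates are exponentially small: `(1 + w) / (1 - w)` has real part at least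
`1 / 2` on the disc `|w| ≤ 1 / 3`, so the map preserves the disc of radius `e^{-t/4} ≤ 1 / 3`. -/
lemma norm_subordIter_le_exp {t : ℝ} (ht : 0 ≤ t) (ht' : Real.exp (-t / 4) ≤ 1 / 3) (k : ℕ)
    {z : ℂ} (hz : ‖z‖ < 1) : ‖subordIter t k z‖ ≤ Real.exp (-t / 4) := by
  induction k with
  | zero => simpa [subordIter] using (Real.exp_pos _).le
  | succ k ih =>
    rw [norm_subordIter_succ]
    have hw : ‖subordIter t k z‖ ≤ 1 / 3 := ih.trans ht'
    have h0 : 1 / 2 ≤ ((1 + subordIter t k z) / (1 - subordIter t k z)).re := by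
      refine le_trans ?_ (one_sub_div_one_add_le_re (norm_subordIter_lt_one ht k hz))
      rw [div_le_div_iff₀ (by norm_num) (by positivity)]
      linarith
    calc ‖z‖ * _ ≤ 1 * Real.exp (-t / 4) := by
          gcongr
          nlinarith
      _ = _ := one_mul _

lemma subordIter_zero_right (t : ℝ) (k : ℕ) : subordIter t k 0 = 0 := by
  cases k <;> simp [subordIter]

lemma differentiableOn_subordIter {t : ℝ} (ht : 0 ≤ t) (k : ℕ) :
    DifferentiableOn ℂ (subordIter t k) (Metric.ball 0 1) := by
  induction k with
  | zero => exact differentiableOn_const _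
  | succ k ih =>
    refine differentiableOn_id.mul (((((differentiableOn_const _).add ih).div
      ((differentiableOn_const _).sub ih) fun z hz => ?_).const_mul _).cexp)
    exact one_sub_subordIter_ne_zero ht k (by simpa using hz)

lemma differentiableOn_momentApprox {t : ℝ} (ht : 0 ≤ t) (k : ℕ) :
    DifferentiableOn ℂ (momentApprox t k) (Metric.ball 0 1) := by
  refine (differentiableOn_subordIter ht k).div
    ((differentiableOn_const _).sub (differentiableOn_subordIter ht k)) fun z hz => ?_
  exact one_sub_subordIter_ne_zero ht k (by simpa using hz)

lemma analyticAt_momentApprox {t : ℝ} (ht : 0 ≤ t) (k : ℕ) : AnalyticAt ℂ (momentApprox t k) 0 :=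
  (differentiableOn_momentApprox ht k).analyticAt (Metric.ball_mem_nhds _ one_pos)

lemma momentApprox_zero_right (t : ℝ) (k : ℕ) : momentApprox t k 0 = 0 := by
  simp [momentApprox, subordIter_zero_right]

lemma one_add_two_mul_momentApprox {t : ℝ} (ht : 0 ≤ t) (k : ℕ) {z : ℂ} (hz : ‖z‖ < 1) :
    (1 + subordIter t k z) / (1 - subordIter t k z) = 1 + 2 * momentApprox t k z := by
  have := one_sub_subordIter_ne_zero ht k hz
  rw [momentApprox]
  field_simp
  ring

/-- The derivative of an iterate, from the logarithmic derivative of the defining relation. -/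
lemma hasDerivAt_momentApprox_succ {t : ℝ} (ht : 0 ≤ t) (k : ℕ) {z : ℂ} (hz : ‖z‖ < 1) :
    HasDerivAt (momentApprox t (k + 1))
      ((Complex.exp (-((t : ℂ) / 2) * ((1 + subordIter t k z) / (1 - subordIter t k z))) -
        subordIter t (k + 1) z * ((t : ℂ) * deriv (momentApprox t k) z)) /
          (1 - subordIter t (k + 1) z) ^ 2) z := by
  have hz' : z ∈ Metric.ball (0 : ℂ) 1 := by simpa using hz
  have hnhds : Metric.ball (0 : ℂ) 1 ∈ 𝓝 z := Metric.isOpen_ball.mem_nhds hz'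
  have hM : HasDerivAt (momentApprox t k) (deriv (momentApprox t k) z) z :=
    ((differentiableOn_momentApprox ht k).differentiableAt hnhds).hasDerivAt
  have hG : HasDerivAt (fun z => (1 + subordIter t k z) / (1 - subordIter t k z))
      (2 * deriv (momentApprox t k) z) z := by
    refine HasDerivAt.congr_of_eventuallyEq (f := fun z => 1 + 2 * momentApprox t k z) ?_ ?_
    · exact (hM.const_mul 2).const_add 1
    · filter_upwards [hnhds] with y hy
      exact one_add_two_mul_momentApprox ht k (by simpa using hy)
  have hω : HasDerivAt (subordIter t (k + 1))
      (Complex.exp (-((t : ℂ) / 2) * ((1 + subordIter t k z) / (1 - subordIter t k z))) -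
        subordIter t (k + 1) z * ((t : ℂ) * deriv (momentApprox t k) z)) z := by
    refine ((hasDerivAt_id z).mul ((hG.const_mul (-((t : ℂ) / 2))).cexp)).congr_deriv ?_
    simp only [subordIter, id]
    ring
  have hne := one_sub_subordIter_ne_zero ht (k + 1) hz
  refine (hω.div (hω.const_sub 1) hne).congr_deriv ?_
  field_simp
  ring

lemma id_mul_deriv_momentApprox_succ {t : ℝ} (ht : 0 ≤ t) (k : ℕ) {z : ℂ} (hz : ‖z‖ < 1) :
    z * deriv (momentApprox t (k + 1)) z =
      (momentApprox t (k + 1) z + momentApprox t (k + 1) z * momentApprox t (k + 1) z) *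
        (1 - t * (z * deriv (momentApprox t k) z)) := by
  rw [(hasDerivAt_momentApprox_succ ht k hz).deriv]
  have hne := one_sub_subordIter_ne_zero ht (k + 1) hz
  set d := deriv (momentApprox t k) z
  have hω : z * Complex.exp (-((t : ℂ) / 2) *
      ((1 + subordIter t k z) / (1 - subordIter t k z))) = subordIter t (k + 1) z := rfl
  set e := Complex.exp (-((t : ℂ) / 2) * ((1 + subordIter t k z) / (1 - subordIter t k z)))
  simp only [momentApprox]
  set w := subordIter t (k + 1) z
  field_simp
  rw [mul_sub, hω]
  ring

lemma coeff_taylorAtZero_momentApprox {t : ℝ} (ht : 0 ≤ t) {k n : ℕ} (hn : n ≤ k) :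
    PowerSeries.coeff n (taylorAtZero (momentApprox t k)) = (bianeMoment t n : ℂ) := by
  have hb : ∀ n, PowerSeries.coeff n (bianeSeries t) = (bianeMoment t n : ℂ) :=
    fun n => PowerSeries.coeff_mk _ _
  have h0 : ∀ k, PowerSeries.coeff 0 (taylorAtZero (momentApprox t k)) = 0 := by
    intro k
    rw [coeff_taylorAtZero, iteratedDeriv_zero, momentApprox_zero_right, zero_div]
  have hb0 : PowerSeries.coeff 0 (bianeSeries t) = 0 := by
    rw [hb, bianeMoment_zero_right, Complex.ofReal_zero]
  rw [← hb]
  induction k generalizing n with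
  | zero =>
    rw [Nat.le_zero.1 hn, h0, hb0]
  | succ k ih =>
    refine coeff_eq_of_euler_eq (bianeSeries_functional_eq t) ?_ hb0 (h0 _) ?_ (fun n hn => ih hn) hn
    · have hA := analyticAt_momentApprox ht (k + 1)
      have hB := analyticAt_momentApprox ht k
      have hD : AnalyticAt ℂ (fun z => z * deriv (momentApprox t k) z) 0 :=
        analyticAt_id.mul hB.deriv
      have heq : (fun z => z * deriv (momentApprox t (k + 1)) z) =ᶠ[𝓝 0]
          (momentApprox t (k + 1) + momentApprox t (k + 1) * momentApprox t (k + 1)) *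
            ((fun _ => (1 : ℂ)) - (fun _ => (t : ℂ)) *
              fun z => z * deriv (momentApprox t k) z) := by
        filter_upwards [Metric.ball_mem_nhds (0 : ℂ) one_pos] with z hz
        exact id_mul_deriv_momentApprox_succ ht k (by simpa using hz)
      have h := taylorAtZero_congr heq
      rw [taylorAtZero_id_mul_deriv hA, taylorAtZero_mul (hA.add (hA.mul hA))
        (analyticAt_const.sub (analyticAt_const.mul hD)), taylorAtZero_add hA (hA.mul hA),
        taylorAtZero_mul hA hA, taylorAtZero_sub analyticAt_const (analyticAt_const.mul hD),
        taylorAtZero_mul analyticAt_const hD, taylorAtZero_const, taylorAtZero_const,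
        taylorAtZero_id_mul_deriv hB, map_one] at h
      exact h
    · rw [hb, bianeMoment_one, coeff_taylorAtZero, iteratedDeriv_one,
        (hasDerivAt_momentApprox_succ ht k (by simp)).deriv]
      simp [subordIter_zero_right]

/-- The lower bound on the real part that quantifies how far the limiting spectral measure is from
the uniform distribution. -/
lemma one_sub_min_le_re_momentApprox {t : ℝ} (ht : 0 ≤ t) (k : ℕ) {z : ℂ} (hz : ‖z‖ < 1) :
    1 - min 1 (3 * Real.exp (-t / 4)) ≤ (1 + 2 * momentApprox t k z).re := by
  rcases le_or_gt (Real.exp (-t / 4)) (1 / 3) with h | h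
  · rw [min_eq_right (by linarith)]
    have hw := norm_subordIter_le_exp ht h k hz
    have hne := one_sub_subordIter_ne_zero ht k hz
    have h1 : 2 / 3 ≤ ‖1 - subordIter t k z‖ := by
      have := norm_sub_norm_le (1 : ℂ) (subordIter t k z)
      rw [norm_one] at this
      linarith
    have h2 : ‖2 * momentApprox t k z‖ ≤ 3 * Real.exp (-t / 4) := by
      rw [momentApprox, norm_mul, norm_div, Complex.norm_ofNat, mul_div_assoc',
        div_le_iff₀ (by linarith)]
      nlinarith [Real.exp_pos (-t / 4), norm_nonneg (subordIter t k z)]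
    have h3 := (Complex.abs_re_le_norm (2 * momentApprox t k z)).trans h2
    rw [Complex.add_re, Complex.one_re]
    linarith [(abs_le.1 h3).1]
  · rw [min_eq_left (by linarith), sub_self, ← one_add_two_mul_momentApprox ht k hz]
    have hw := norm_subordIter_lt_one ht k hz
    exact (div_nonneg (by linarith) (by positivity)).trans (one_sub_div_one_add_le_re hw)

/-! ### Measures on the circle and their moments -/

instance : IsProbabilityMeasure uniformCircle := by
  have hpi : (0 : ℝ) < 2 * Real.pi := by positivity
  have h : IsProbabilityMeasure ((ENNReal.ofReal (2 * Real.pi))⁻¹ •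
      volume.restrict (Set.Ioc 0 (2 * Real.pi))) := by
    constructor
    rw [Measure.smul_apply, Measure.restrict_apply_univ, Real.volume_Ioc, sub_zero, smul_eq_mul,
      ENNReal.inv_mul_cancel (by simpa using hpi) ENNReal.ofReal_ne_top]
  exact Measure.isProbabilityMeasure_map Circle.exp.continuous.measurable.aemeasurable

lemma integrable_circle {E : Type*} [NormedAddCommGroup E] [SecondCountableTopology E]
    (μ : Measure Circle) [IsFiniteMeasure μ] {f : Circle → E} (hf : Continuous f) :
    Integrable f μ :=
  integrableOn_univ.1 (hf.continuousOn.integrableOn_compact isCompact_univ)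

/-- Integrals against the uniform measure are averages over circles. -/
lemma integral_uniformCircle {r : ℝ} (F : ℂ → ℂ)
    (hF : Continuous fun z : Circle => F ((r : ℂ) * z)) :
    ∫ z : Circle, F ((r : ℂ) * z) ∂uniformCircle = Real.circleAverage F 0 r := by
  have hpi : (0 : ℝ) < 2 * Real.pi := by positivity
  rw [uniformCircle, integral_map Circle.exp.continuous.measurable.aemeasurable
    hF.aestronglyMeasurable, integral_smul_measure, Real.circleAverage_def,
    intervalIntegral.integral_of_le hpi.le, ENNReal.toReal_inv, ENNReal.toReal_ofReal hpi.le]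
  simp [circleMap]

lemma differentiableOn_closedBall_of_lt_one {F : ℂ → ℂ} (hF : DifferentiableOn ℂ F (Metric.ball 0 1)) {r : ℝ}
    (hr : r < 1) : DifferentiableOn ℂ F (Metric.closedBall 0 r) :=
  hF.mono (Metric.closedBall_subset_ball hr)

lemma continuous_comp_mul_circle {F : ℂ → ℂ} (hF : DifferentiableOn ℂ F (Metric.ball 0 1)) {r : ℝ}
    (hr0 : 0 < r) (hr : r < 1) : Continuous fun z : Circle => F ((r : ℂ) * z) := by
  refine hF.continuousOn.comp_continuous (by fun_prop) fun z => ?_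
  rw [mem_ball_zero_iff, norm_mul, Circle.norm_coe, mul_one, Complex.norm_real, Real.norm_eq_abs,
    abs_of_pos hr0]
  exact hr

/-- The negative Fourier coefficients of a holomorphic function on a circle vanish. -/
lemma integral_uniformCircle_mul_pow {F : ℂ → ℂ} (hF : DifferentiableOn ℂ F (Metric.ball 0 1))
    {r : ℝ} (hr0 : 0 < r) (hr : r < 1) (n : ℕ) :
    ∫ z : Circle, F ((r : ℂ) * z) * (z : ℂ) ^ n ∂uniformCircle = F 0 * 0 ^ n := by
  have hr' : (r : ℂ) ≠ 0 := by exact_mod_cast hr0.ne'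
  have hG : DifferentiableOn ℂ (fun z => F z * (z / r) ^ n) (Metric.ball 0 1) :=
    hF.mul ((differentiableOn_id.div_const _).pow n)
  have h := integral_uniformCircle (r := r) (fun z => F z * (z / r) ^ n)
    (continuous_comp_mul_circle hG hr0 hr)
  have e : ∀ z : Circle, F ((r : ℂ) * z) * (((r : ℂ) * z) / r) ^ n = F ((r : ℂ) * z) * (z : ℂ) ^ n :=
    fun z => by rw [mul_div_cancel_left₀ _ hr']
  simp only [e] at h
  rw [h, DiffContOnCl.circleAverage]
  · simp
  · rw [abs_of_pos hr0]
    exact ((differentiableOn_closedBall_of_lt_one hG hr).mono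
      Metric.closure_ball_subset_closedBall).diffContOnCl

/-- The Fourier coefficients of a holomorphic function on a circle are its Taylor coefficients. -/
lemma integral_uniformCircle_mul_inv_pow {F : ℂ → ℂ}
    (hF : DifferentiableOn ℂ F (Metric.ball 0 1)) {r : ℝ} (hr0 : 0 < r) (hr : r < 1) (n : ℕ) :
    ∫ z : Circle, F ((r : ℂ) * z) * ((z : ℂ)⁻¹) ^ n ∂uniformCircle =
      (r : ℂ) ^ n * (iteratedDeriv n F 0 / (n.factorial : ℂ)) := by
  have hr' : (r : ℂ) ≠ 0 := by exact_mod_cast hr0.ne'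
  have e : ∀ z : Circle, F ((r : ℂ) * z) * (r / ((r : ℂ) * z)) ^ n =
      F ((r : ℂ) * z) * ((z : ℂ)⁻¹) ^ n := by
    intro z
    have : (r : ℂ) / ((r : ℂ) * z) = (z : ℂ)⁻¹ := by
      have := z.coe_ne_zero
      field_simp
    rw [this]
  have h := integral_uniformCircle (r := r) (fun z => F z * (r / z) ^ n) (by
    simp only [e]
    refine (continuous_comp_mul_circle hF hr0 hr).mul (Continuous.pow ?_ n)
    exact continuous_subtype_val.inv₀ fun z => Circle.coe_ne_zero z)
  simp only [e] at h
  have hC := DifferentiableOn.circleIntegral_one_div_sub_center_pow_smul hr0 n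
    (differentiableOn_closedBall_of_lt_one hF hr)
  rw [h, Real.circleAverage_eq_circleIntegral hr0.ne']
  have e2 : (fun z : ℂ => (z - 0)⁻¹ • (F z * (r / z) ^ n)) =
      fun z => (r : ℂ) ^ n • ((1 / (z - 0) ^ (n + 1)) • F z) := by
    funext z
    simp only [smul_eq_mul, sub_zero, div_pow, pow_succ]
    field_simp
  rw [e2, circleIntegral.integral_smul, hC]
  have h2 : (2 * (Real.pi : ℂ) * Complex.I) ≠ 0 := by
    simp [Real.pi_ne_zero]
  simp only [smul_eq_mul]
  field_simp

/-- The boundary values on a smaller circle of a holomorphic function with nonnegative real part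
form the density of a probability measure, whose moments are given by the Taylor coefficients. -/
lemma exists_measure_of_re_nonneg {F : ℂ → ℂ} (hF : DifferentiableOn ℂ F (Metric.ball 0 1))
    (hF0 : F 0 = 1) (hre : ∀ z ∈ Metric.ball (0 : ℂ) 1, 0 ≤ (F z).re) {r : ℝ} (hr0 : 0 < r)
    (hr : r < 1) :
    ∃ μ : ProbabilityMeasure Circle, ∀ n : ℕ, n ≠ 0 →
      ∫ z, (z : ℂ) ^ n ∂(μ : Measure Circle) =
        (starRingEnd ℂ) ((r : ℂ) ^ n * (iteratedDeriv n F 0 / (n.factorial : ℂ))) / 2 := by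
  have hcont : Continuous fun z : Circle => F ((r : ℂ) * z) := continuous_comp_mul_circle hF hr0 hr
  have hcre : Continuous fun z : Circle => (F ((r : ℂ) * z)).re :=
    Complex.continuous_re.comp hcont
  have hpos : ∀ z : Circle, 0 ≤ (F ((r : ℂ) * z)).re := fun z => hre _ (by
    rw [mem_ball_zero_iff, norm_mul, Circle.norm_coe, mul_one, Complex.norm_real, Real.norm_eq_abs,
      abs_of_pos hr0]
    exact hr)
  let μ : Measure Circle := uniformCircle.withDensity fun z => ENNReal.ofReal (F ((r : ℂ) * z)).re
  have hint : ∀ g : Circle → ℂ, Continuous g →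
      ∫ z, g z ∂μ = (∫ z, F ((r : ℂ) * z) * g z ∂uniformCircle +
        (starRingEnd ℂ) (∫ z, F ((r : ℂ) * z) * (starRingEnd ℂ) (g z) ∂uniformCircle)) / 2 := by
    intro g hg
    rw [integral_withDensity_eq_integral_toReal_smul hcre.measurable.ennreal_ofReal
      (ae_of_all _ fun z => ENNReal.ofReal_lt_top), ← integral_conj, ← integral_add,
      ← integral_div]
    · refine integral_congr_ae (ae_of_all _ fun z => ?_)
      simp only [ENNReal.toReal_ofReal (hpos z), map_mul, Complex.conj_conj]
      rw [← add_mul, Complex.add_conj, Complex.real_smul]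
      push_cast
      ring
    · exact integrable_circle _ (hcont.mul hg)
    · refine integrable_circle _ ?_
      exact Complex.continuous_conj.comp (hcont.mul (Complex.continuous_conj.comp hg))
  have hμ : IsProbabilityMeasure μ := by
    constructor
    have h1 : ∫ z : Circle, (F ((r : ℂ) * z)).re ∂uniformCircle = 1 := by
      have h := integral_uniformCircle_mul_pow hF hr0 hr 0
      simp only [pow_zero, mul_one, hF0] at h
      have h' := congrArg Complex.re h
      rw [Complex.one_re] at h'
      rw [← h']
      exact (integral_re (𝕜 := ℂ) (integrable_circle _ hcont))
    rw [withDensity_apply _ MeasurableSet.univ, Measure.restrict_univ,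
      ← ofReal_integral_eq_lintegral_ofReal (integrable_circle _ hcre) (ae_of_all _ hpos), h1,
      ENNReal.ofReal_one]
  refine ⟨⟨μ, hμ⟩, fun n hn => ?_⟩
  change ∫ z, (z : ℂ) ^ n ∂μ = _
  rw [hint _ (by fun_prop), integral_uniformCircle_mul_pow hF hr0 hr, zero_pow hn, mul_zero,
    zero_add, ← integral_uniformCircle_mul_inv_pow hF hr0 hr]
  congr 3
  funext z
  simp only [map_pow]
  rw [← Circle.coe_inv_eq_conj, Circle.coe_inv]

/-- Limits of moment sequences of probability measures on the circle are moment sequences, by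
compactness. -/
lemma exists_measure_of_tendsto_moments {μ : ℕ → ProbabilityMeasure Circle} {a : ℕ → ℂ}
    (h : ∀ n : ℕ, n ≠ 0 →
      Tendsto (fun k => ∫ z, (z : ℂ) ^ n ∂(μ k : Measure Circle)) atTop (𝓝 (a n))) :
    ∃ ν : ProbabilityMeasure Circle, ∀ n : ℕ, n ≠ 0 →
      ∫ z, (z : ℂ) ^ n ∂(ν : Measure Circle) = a n := by
  let U : Ultrafilter (ProbabilityMeasure Circle) := Ultrafilter.map μ (hyperfilter ℕ)
  obtain ⟨ν, -, hν⟩ := isCompact_univ.ultrafilter_le_nhds U (by simp)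
  have hν' : Tendsto μ (hyperfilter ℕ) (𝓝 ν) := hν
  refine ⟨ν, fun n hn => ?_⟩
  rw [ProbabilityMeasure.tendsto_iff_forall_integral_rclike_tendsto ℂ] at hν'
  have h1 := hν' (BoundedContinuousFunction.mkOfCompact ⟨fun z : Circle => (z : ℂ) ^ n, by fun_prop⟩)
  have h2 := (h n hn).mono_left (Nat.hyperfilter_le_atTop)
  exact tendsto_nhds_unique h1 h2

/-- A form of the **Herglotz representation theorem**: holomorphic functions on the disc with
nonnegative real part whose Taylor coefficients converge define, in the limit, a probability
measure on the circle. -/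
lemma exists_measure_of_tendsto_taylor {F : ℕ → ℂ → ℂ} {a : ℕ → ℝ}
    (hF : ∀ k, DifferentiableOn ℂ (F k) (Metric.ball 0 1)) (hF0 : ∀ k, F k 0 = 1)
    (hre : ∀ k, ∀ z ∈ Metric.ball (0 : ℂ) 1, 0 ≤ (F k z).re)
    (ha : ∀ n : ℕ, n ≠ 0 → Tendsto (fun k => iteratedDeriv n (F k) 0 / (n.factorial : ℂ)) atTop
      (𝓝 (2 * (a n : ℂ)))) :
    ∃ ν : ProbabilityMeasure Circle, ∀ n : ℕ, n ≠ 0 →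
      ∫ z, (z : ℂ) ^ n ∂(ν : Measure Circle) = a n := by
  have hr0 : ∀ k : ℕ, (0 : ℝ) < 1 - 1 / ((k : ℝ) + 2) := fun k => by
    rw [sub_pos, div_lt_one (by positivity)]
    have : (0 : ℝ) ≤ k := by positivity
    linarith
  have hr1 : ∀ k : ℕ, 1 - 1 / ((k : ℝ) + 2) < 1 := fun k => by
    have : (0 : ℝ) < 1 / ((k : ℝ) + 2) := by positivity
    linarith
  choose μ hμ using fun k : ℕ => exists_measure_of_re_nonneg (hF k) (hF0 k) (hre k) (hr0 k) (hr1 k)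
  refine exists_measure_of_tendsto_moments (μ := μ) fun n hn => ?_
  simp only [hμ _ n hn]
  have hr : Tendsto (fun k : ℕ => 1 - 1 / ((k : ℝ) + 2)) atTop (𝓝 1) := by
    have h1 : Tendsto (fun k : ℕ => (k : ℝ) + 2) atTop atTop :=
      tendsto_atTop_add_const_right _ _ tendsto_natCast_atTop_atTop
    have h2 := (h1.inv_tendsto_atTop).const_sub 1
    rw [sub_zero] at h2
    simpa only [one_div] using! h2
  have hr' : Tendsto (fun k : ℕ => (((1 - 1 / ((k : ℝ) + 2) : ℝ) : ℂ)) ^ n) atTop (𝓝 1) := by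
    have h1 := ((Complex.continuous_ofReal.tendsto 1).comp hr).pow n
    rw [Complex.ofReal_one, one_pow] at h1
    exact h1
  have h3 := ((Complex.continuous_conj.tendsto _).comp (hr'.mul (ha n hn))).div_const 2
  have e : (starRingEnd ℂ) (1 * (2 * (a n : ℂ))) / 2 = a n := by
    have h2 : (starRingEnd ℂ) (2 : ℂ) = 2 := Complex.conj_ofNat 2
    rw [one_mul, map_mul, h2, Complex.conj_ofReal, mul_div_cancel_left₀ _ two_ne_zero]
  rw [e] at h3
  exact h3

/-- On the circle, convergence of all moments implies weak convergence: trigonometric polynomials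
are dense in the continuous functions. -/
lemma tendsto_integral_of_tendsto_moments {μ : ℕ → Measure Circle} {ν : Measure Circle}
    [∀ k, IsProbabilityMeasure (μ k)] [IsProbabilityMeasure ν]
    (h : ∀ n : ℕ, n ≠ 0 → Tendsto (fun k => ∫ z, (z : ℂ) ^ n ∂(μ k)) atTop
      (𝓝 (∫ z, (z : ℂ) ^ n ∂ν))) (f : C(Circle, ℝ)) :
    Tendsto (fun k => ∫ z, f z ∂(μ k)) atTop (𝓝 (∫ z, f z ∂ν)) := by
  have : Fact (0 < 2 * Real.pi) := ⟨by positivity⟩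
  let H := AddCircle.homeomorphCircle'
  have hcont : ∀ g : C(AddCircle (2 * Real.pi), ℂ), Continuous fun z => g (H.symm z) :=
    fun g => g.continuous.comp H.symm.continuous
  let S : Submodule ℂ C(AddCircle (2 * Real.pi), ℂ) :=
    { carrier := {g | Tendsto (fun k => ∫ z, g (H.symm z) ∂(μ k)) atTop
        (𝓝 (∫ z, g (H.symm z) ∂ν))}
      add_mem' := by
        intro g₁ g₂ h₁ h₂
        simp only [Set.mem_ofPred_eq, ContinuousMap.add_apply] at *
        have e : ∀ m : Measure Circle, IsProbabilityMeasure m →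
            ∫ z, (g₁ (H.symm z) + g₂ (H.symm z)) ∂m =
              ∫ z, g₁ (H.symm z) ∂m + ∫ z, g₂ (H.symm z) ∂m := fun m _ =>
          integral_add (integrable_circle m (hcont g₁)) (integrable_circle m (hcont g₂))
        simp only [e _ inferInstance]
        exact h₁.add h₂
      zero_mem' := by simp
      smul_mem' := by
        intro c g hg
        simp only [Set.mem_ofPred_eq, ContinuousMap.smul_apply, integral_smul] at *
        exact hg.const_smul c }
  have hfour : ∀ n : ℤ, ∀ z : Circle, fourier n (H.symm z) = ((z ^ n : Circle) : ℂ) := by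
    intro n z
    obtain ⟨x, rfl⟩ := H.surjective z
    rw [H.symm_apply_apply]
    induction x using QuotientAddGroup.induction_on with
    | H x =>
      have e1 : H ((x : ℝ) : AddCircle (2 * Real.pi)) = Circle.exp x :=
        AddCircle.homeomorphCircle'_apply_mk x
      rw [e1, fourier_apply, AddCircle.toCircle_zsmul]
      congr 2
      rw [AddCircle.toCircle_apply_mk]
      congr 1
      field_simp
  have hmem : ∀ n : ℤ, fourier n ∈ S := by
    have hpos : ∀ n : ℕ, Tendsto (fun k => ∫ z, (z : ℂ) ^ n ∂(μ k)) atTop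
        (𝓝 (∫ z, (z : ℂ) ^ n ∂ν)) := by
      intro n
      rcases eq_or_ne n 0 with rfl | hn
      · simp
      · exact h n hn
    intro n
    change Tendsto (fun k => ∫ z, fourier n (H.symm z) ∂(μ k)) atTop
        (𝓝 (∫ z, fourier n (H.symm z) ∂ν))
    simp only [hfour]
    rcases Int.eq_nat_or_neg n with ⟨m, rfl | rfl⟩
    · simpa using! hpos m
    · have e : ∀ z : Circle, ((z ^ (-(m : ℤ)) : Circle) : ℂ) = (starRingEnd ℂ) ((z : ℂ) ^ m) := by
        intro z
        rw [zpow_neg, Circle.coe_inv_eq_conj]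
        simp
      simp only [e, integral_conj]
      exact (Complex.continuous_conj.tendsto _).comp (hpos m)
  have hdense : ∀ g : C(AddCircle (2 * Real.pi), ℂ), g ∈ S := by
    intro g
    have hspan : Submodule.span ℂ (Set.range (fourier (T := 2 * Real.pi))) ≤ S :=
      Submodule.span_le.2 (by rintro _ ⟨n, rfl⟩; exact hmem n)
    have hg : g ∈ (Submodule.span ℂ (Set.range (fourier (T := 2 * Real.pi)))).topologicalClosure := by
      rw [span_fourier_closure_eq_top]; trivial
    change Tendsto _ _ _
    rw [Metric.tendsto_atTop]
    intro ε hε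
    obtain ⟨p, hp, hgp⟩ := Metric.mem_closure_iff.1 hg (ε / 3) (by positivity)
    obtain ⟨K, hK⟩ := (Metric.tendsto_atTop.1 (show Tendsto (fun k => ∫ z, p (H.symm z) ∂(μ k)) atTop
        (𝓝 (∫ z, p (H.symm z) ∂ν)) from hspan hp)) (ε / 3) (by positivity)
    refine ⟨K, fun k hk => ?_⟩
    have key : ∀ m : Measure Circle, IsProbabilityMeasure m →
        dist (∫ z, g (H.symm z) ∂m) (∫ z, p (H.symm z) ∂m) ≤ ε / 3 := by
      intro m _
      rw [dist_eq_norm, ← integral_sub (integrable_circle m (hcont g)) (integrable_circle m (hcont p))]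
      refine (norm_integral_le_of_norm_le_const (C := ε / 3) (ae_of_all _ fun z => ?_)).trans ?_
      · rw [← dist_eq_norm]
        exact (ContinuousMap.dist_apply_le_dist _).trans hgp.le
      · simp
    have h1 := key (μ k) inferInstance
    have h2 := key ν inferInstance
    have h3 := hK k hk
    rw [dist_comm] at h2
    have h4 := dist_triangle4 (∫ z, g (H.symm z) ∂(μ k)) (∫ z, p (H.symm z) ∂(μ k))
      (∫ z, p (H.symm z) ∂ν) (∫ z, g (H.symm z) ∂ν)
    linarith
  have hf := hdense ⟨fun x => (f (H x) : ℂ), by fun_prop⟩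
  have hf' : Tendsto (fun k => ∫ z, (f z : ℂ) ∂(μ k)) atTop (𝓝 (∫ z, (f z : ℂ) ∂ν)) := by
    have := show Tendsto (fun k => ∫ z, (f (H (H.symm z)) : ℂ) ∂(μ k)) atTop
        (𝓝 (∫ z, (f (H (H.symm z)) : ℂ) ∂ν)) from hf
    simpa only [H.apply_symm_apply] using this
  have h5 := (Complex.continuous_re.tendsto _).comp hf'
  have e : ∀ m : Measure Circle, (∫ z, (f z : ℂ) ∂m).re = ∫ z, f z ∂m := fun m => by
    rw [integral_complex_ofReal, Complex.ofReal_re]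
  simpa only [Function.comp_def, e] using h5

/-! ### The limiting spectral measures -/

/-- A convex combination of `μ₀` and `σ` is close to `μ₀`: couple the common part diagonally and the
rest independently. -/
lemma wasserstein1_mixture_le {ε : ℝ} (h0 : 0 ≤ ε) (h1 : ε ≤ 1) (μ₀ σ : Measure Circle)
    [IsProbabilityMeasure μ₀] [IsProbabilityMeasure σ] :
    wasserstein1 (ENNReal.ofReal (1 - ε) • μ₀ + ENNReal.ofReal ε • σ) μ₀ ≤
      ENNReal.ofReal (2 * ε) := by
  have hdiag : Measurable fun z : Circle => (z, z) := measurable_id.prodMk measurable_id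
  refine (iInf₂_le (ENNReal.ofReal (1 - ε) • μ₀.map (fun z => (z, z)) +
    ENNReal.ofReal ε • σ.prod μ₀) (And.intro ?fst ?snd)).trans ?cost
  case fst =>
    rw [Measure.map_add _ _ measurable_fst, Measure.map_smul, Measure.map_smul,
      Measure.map_map measurable_fst hdiag, Measure.map_fst_prod]
    have e : (Prod.fst ∘ fun z : Circle => (z, z)) = id := rfl
    rw [e, Measure.map_id, measure_univ, one_smul]
  case snd =>
    rw [Measure.map_add _ _ measurable_snd, Measure.map_smul, Measure.map_smul,
      Measure.map_map measurable_snd hdiag, Measure.map_snd_prod]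
    have e : (Prod.snd ∘ fun z : Circle => (z, z)) = id := rfl
    rw [e, Measure.map_id, measure_univ, one_smul, ← add_smul,
      ← ENNReal.ofReal_add (by linarith) h0, sub_add_cancel, ENNReal.ofReal_one, one_smul]
  case cost =>
    have hdist : ∀ p : Circle × Circle, edist p.1 p.2 ≤ 2 := by
      intro p
      have h : dist p.1 p.2 ≤ 2 := by
        have e : dist p.1 p.2 = ‖(p.1 : ℂ) - (p.2 : ℂ)‖ := by rw [← dist_eq_norm]; rfl
        rw [e]
        refine (norm_sub_le _ _).trans ?_
        rw [Circle.norm_coe, Circle.norm_coe]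
        norm_num
      rw [edist_dist]
      exact (ENNReal.ofReal_le_ofReal h).trans (by simp)
    rw [lintegral_add_measure, lintegral_smul_measure, lintegral_smul_measure,
      lintegral_map (by fun_prop) hdiag]
    simp only [edist_self, lintegral_zero, mul_zero, zero_add, smul_eq_mul]
    calc ENNReal.ofReal ε * ∫⁻ p, edist p.1 p.2 ∂(σ.prod μ₀)
        ≤ ENNReal.ofReal ε * ∫⁻ _, 2 ∂(σ.prod μ₀) := by
          gcongr with p
          exact hdist p
      _ = ENNReal.ofReal (2 * ε) := by
          rw [lintegral_const, measure_univ, mul_one, mul_comm 2 ε, ENNReal.ofReal_mul h0]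
          simp

lemma integral_uniformCircle_pow {n : ℕ} (hn : n ≠ 0) :
    ∫ z : Circle, (z : ℂ) ^ n ∂uniformCircle = 0 := by
  have h := integral_uniformCircle_mul_pow (F := fun _ => 1) (differentiableOn_const _)
    (r := 1 / 2) (by norm_num) (by norm_num) n
  simpa [hn] using h

/-- The limiting spectral measure exists and is close to uniform: it is a mixture of the uniform
measure and of a probability measure of weight at most `3 e^{-t/4}`. -/
lemma exists_measure_bianeMoment {t : ℝ} (ht : 0 ≤ t) :
    ∃ ν : Measure Circle, IsProbabilityMeasure ν ∧
      (∀ n : ℕ, n ≠ 0 → ∫ z, (z : ℂ) ^ n ∂ν = bianeMoment t n) ∧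
      wasserstein1 ν uniformCircle ≤ ENNReal.ofReal (6 * Real.exp (-t / 4)) := by
  set ε := min 1 (3 * Real.exp (-t / 4)) with hε
  have hε0 : 0 < ε := lt_min one_pos (by positivity)
  have hε1 : ε ≤ 1 := min_le_left _ _
  have hεc : (ε : ℂ) ≠ 0 := by exact_mod_cast hε0.ne'
  let F : ℕ → ℂ → ℂ := fun k => (fun _ => (1 : ℂ)) + (fun _ => (2 / ε : ℂ)) * momentApprox t k
  have hF : ∀ k z, F k z = 1 + 2 / ε * momentApprox t k z := fun _ _ => rfl
  obtain ⟨σ, hσ⟩ := exists_measure_of_tendsto_taylor (F := F) (a := fun n => bianeMoment t n / ε)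
    (fun k => (differentiableOn_const _).add
      ((differentiableOn_const _).mul (differentiableOn_momentApprox ht k)))
    (fun k => by rw [hF, momentApprox_zero_right, mul_zero, add_zero])
    (fun k z hz => by
      have h := one_sub_min_le_re_momentApprox ht k (by simpa using hz : ‖z‖ < 1)
      rw [← hε, Complex.add_re, Complex.one_re] at h
      have e : (2 / ε : ℂ) * momentApprox t k z =
          ((1 / ε : ℝ) : ℂ) * (2 * momentApprox t k z) := by
        push_cast
        ring
      rw [hF, e, Complex.add_re, Complex.one_re, Complex.re_ofReal_mul, one_div_mul_eq_div]
      have h2 : -1 ≤ (2 * momentApprox t k z).re / ε := by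
        rw [le_div_iff₀ hε0]
        linarith
      linarith)
    (fun n hn => by
      refine tendsto_const_nhds.congr' ?_
      filter_upwards [eventually_ge_atTop n] with k hk
      have hA := analyticAt_momentApprox ht k
      rw [← coeff_taylorAtZero, taylorAtZero_add analyticAt_const (analyticAt_const.mul hA),
        taylorAtZero_mul analyticAt_const hA, taylorAtZero_const, taylorAtZero_const, map_add,
        PowerSeries.coeff_C_mul, PowerSeries.coeff_C, if_neg hn,
        coeff_taylorAtZero_momentApprox ht hk]
      push_cast
      ring)
  refine ⟨ENNReal.ofReal (1 - ε) • uniformCircle + ENNReal.ofReal ε • (σ : Measure Circle),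
    ⟨?_⟩, fun n hn => ?_, ?_⟩
  · simp only [Measure.add_apply, Measure.smul_apply, measure_univ, smul_eq_mul, mul_one]
    rw [← ENNReal.ofReal_add (by linarith) hε0.le, sub_add_cancel, ENNReal.ofReal_one]
  · have hi : ∀ m : Measure Circle, IsProbabilityMeasure m → ∀ c : ℝ,
        Integrable (fun z : Circle => (z : ℂ) ^ n) (ENNReal.ofReal c • m) := fun m _ c =>
      (integrable_circle m (by fun_prop)).smul_measure ENNReal.ofReal_ne_top
    rw [integral_add_measure (hi _ inferInstance _) (hi _ inferInstance _), integral_smul_measure,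
      integral_smul_measure, hσ n hn, integral_uniformCircle_pow hn, smul_zero, zero_add,
      ENNReal.toReal_ofReal hε0.le, Complex.real_smul]
    push_cast
    field_simp
  · refine (wasserstein1_mixture_le hε0.le hε1 _ _).trans (ENNReal.ofReal_le_ofReal ?_)
    have : ε ≤ 3 * Real.exp (-t / 4) := min_le_right _ _
    linarith

lemma abs_bianeMoment_le_one {t : ℝ} (ht : 0 ≤ t) (n : ℕ) : |bianeMoment t n| ≤ 1 := by
  rcases eq_or_ne n 0 with rfl | hn
  · simp [bianeMoment_zero_right]
  obtain ⟨ν, hν, hm, -⟩ := exists_measure_bianeMoment ht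
  have h : ‖∫ z : Circle, (z : ℂ) ^ n ∂ν‖ ≤ 1 := by
    refine (norm_integral_le_of_norm_le_const (C := 1) (ae_of_all _ fun z => ?_)).trans ?_
    · rw [norm_pow, Circle.norm_coe, one_pow]
    · simp
  rwa [hm n hn, Complex.norm_real, Real.norm_eq_abs] at h

/-! ### Moments of spectral measures -/

/-- The determinant of `p(A)` is the product of the values of `p` at the eigenvalues; by
multiplicativity, linear polynomials suffice. -/
lemma det_aeval_eq_prod_roots {N : ℕ} (A : Matrix (Fin N) (Fin N) ℂ) (p : Polynomial ℂ) :
    (Polynomial.aeval A p).det = (A.charpoly.roots.map fun x => p.eval x).prod := by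
  have hcard : A.charpoly.roots.card = N := by
    rw [IsAlgClosed.card_roots_eq_natDegree, Matrix.charpoly_natDegree_eq_dim, Fintype.card_fin]
  have hC : ∀ c : ℂ, (Polynomial.aeval A (Polynomial.C c)).det =
      (A.charpoly.roots.map fun x => (Polynomial.C c).eval x).prod := by
    intro c
    simp only [Polynomial.aeval_C, Polynomial.eval_C, Multiset.map_const', Multiset.prod_replicate,
      hcard, Algebra.algebraMap_eq_smul_one, Matrix.det_smul, Matrix.det_one, mul_one,
      Fintype.card_fin]
  have hX : ∀ c : ℂ, (Polynomial.aeval A (Polynomial.X - Polynomial.C c)).det =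
      (A.charpoly.roots.map fun x => (Polynomial.X - Polynomial.C c).eval x).prod := by
    intro c
    have h1 : A.charpoly.eval c = (A.charpoly.roots.map fun x => c - x).prod := by
      conv_lhs => rw [(IsAlgClosed.splits A.charpoly).eq_prod_roots_of_monic A.charpoly_monic]
      rw [Polynomial.eval_multiset_prod, Multiset.map_map]
      simp
    have h2 : A.charpoly.eval c = (algebraMap ℂ (Matrix (Fin N) (Fin N) ℂ) c - A).det := by
      rw [Matrix.eval_charpoly]
      rfl
    have h3 : Polynomial.aeval A (Polynomial.X - Polynomial.C c) =
        -(algebraMap ℂ (Matrix (Fin N) (Fin N) ℂ) c - A) := by simp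
    rw [h3, Matrix.det_neg, ← h2, h1, Fintype.card_fin]
    have h4 : ∀ x : ℂ, (Polynomial.X - Polynomial.C c).eval x = (-1) * (c - x) := by
      intro x; simp
    simp only [h4, Multiset.prod_map_mul, Multiset.map_const', Multiset.prod_replicate, hcard]
  have hmul : ∀ p q : Polynomial ℂ, (Polynomial.aeval A p).det =
      (A.charpoly.roots.map fun x => p.eval x).prod → (Polynomial.aeval A q).det =
      (A.charpoly.roots.map fun x => q.eval x).prod → (Polynomial.aeval A (p * q)).det =
      (A.charpoly.roots.map fun x => (p * q).eval x).prod := by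
    intro p q hp hq
    simp only [map_mul, Matrix.det_mul, hp, hq, Polynomial.eval_mul, Multiset.prod_map_mul]
  rw [(IsAlgClosed.splits p).eq_prod_roots]
  refine hmul _ _ (hC _) ?_
  induction p.roots using Multiset.induction_on with
  | empty => simp
  | cons a s ih =>
    rw [Multiset.map_cons, Multiset.prod_cons]
    exact hmul _ _ (hX a) ih

lemma charpoly_pow_eq_prod {N : ℕ} (A : Matrix (Fin N) (Fin N) ℂ) (n : ℕ) :
    (A ^ n).charpoly =
      ((A.charpoly.roots.map fun x => x ^ n).map fun x => Polynomial.X - Polynomial.C x).prod := by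
  refine Polynomial.funext fun c => ?_
  have h1 : (A ^ n).charpoly.eval c =
      (Polynomial.aeval A (Polynomial.C c - Polynomial.X ^ n)).det := by
    rw [Matrix.eval_charpoly]
    simp
    rfl
  rw [h1, det_aeval_eq_prod_roots, Polynomial.eval_multiset_prod, Multiset.map_map,
    Multiset.map_map]
  simp

lemma trace_pow_eq_sum_roots {N : ℕ} (A : Matrix (Fin N) (Fin N) ℂ) (n : ℕ) :
    (A ^ n).trace = (A.charpoly.roots.map fun x => x ^ n).sum := by
  rw [Matrix.trace_eq_sum_roots_charpoly, charpoly_pow_eq_prod,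
    Polynomial.roots_multiset_prod_X_sub_C]

open scoped Matrix.Norms.L2Operator in
lemma norm_eq_one_of_mem_roots_charpoly {N : ℕ} (V : Matrix.unitaryGroup (Fin N) ℂ) {x : ℂ}
    (hx : x ∈ (V : Matrix (Fin N) (Fin N) ℂ).charpoly.roots) : ‖x‖ = 1 := by
  have h1 : x ∈ spectrum ℂ (V : Matrix (Fin N) (Fin N) ℂ) :=
    Matrix.mem_spectrum_iff_isRoot_charpoly.2 (Polynomial.isRoot_of_mem_roots hx)
  simpa using spectrum.subset_circle_of_unitary V.2 h1

lemma exists_circle_roots {N : ℕ} (V : Matrix.unitaryGroup (Fin N) ℂ) :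
    ∃ s : Multiset Circle, s.map (fun z : Circle => (z : ℂ)) =
      (V : Matrix (Fin N) (Fin N) ℂ).charpoly.roots := by
  set r := (V : Matrix (Fin N) (Fin N) ℂ).charpoly.roots with hr
  refine ⟨r.attach.map fun x => ⟨x.1, mem_sphere_zero_iff_norm.2
    (norm_eq_one_of_mem_roots_charpoly V x.2)⟩, ?_⟩
  exact (Multiset.map_map _ _ _).trans r.attach_map_val

lemma multiset_sum_dirac_map (s : Multiset Circle) :
    ((s.map (fun z : Circle => (z : ℂ))).map Measure.dirac).sum =
      ((s.map Measure.dirac).sum).map (fun z : Circle => (z : ℂ)) := by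
  have hc : Measurable fun z : Circle => (z : ℂ) := (by fun_prop : Continuous _).measurable
  induction s using Multiset.induction_on with
  | empty => simp
  | cons a s ih =>
    rw [Multiset.map_cons, Multiset.map_cons, Multiset.sum_cons, ih, Multiset.map_cons,
      Multiset.sum_cons, Measure.map_add _ _ hc]
    congr 1
    exact (Measure.map_dirac' hc a).symm

lemma spectralMeasure_eq {N : ℕ} (V : Matrix.unitaryGroup (Fin N) ℂ) {s : Multiset Circle}
    (hs : s.map (fun z : Circle => (z : ℂ)) =
      (V : Matrix (Fin N) (Fin N) ℂ).charpoly.roots) :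
    spectralMeasure V = (N : ℝ≥0∞)⁻¹ • (s.map Measure.dirac).sum := by
  have he : MeasurableEmbedding fun z : Circle => (z : ℂ) :=
    (Continuous.isClosedEmbedding (X := Circle) (by fun_prop)
      Circle.coe_injective).measurableEmbedding
  rw [spectralMeasure, ← hs, multiset_sum_dirac_map, ← Measure.map_smul, he.comap_map]

instance (s : Multiset Circle) : IsFiniteMeasure (s.map Measure.dirac).sum := by
  induction s using Multiset.induction_on with
  | empty => rw [Multiset.map_zero, Multiset.sum_zero]; infer_instance
  | cons a s ih => rw [Multiset.map_cons, Multiset.sum_cons]; infer_instance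

lemma integral_multiset_sum_dirac (s : Multiset Circle) {f : Circle → ℂ} (hf : Continuous f) :
    ∫ z, f z ∂(s.map Measure.dirac).sum = (s.map f).sum := by
  induction s using Multiset.induction_on with
  | empty => simp
  | cons a s ih =>
    rw [Multiset.map_cons, Multiset.sum_cons, Multiset.map_cons, Multiset.sum_cons,
      integral_add_measure (integrable_circle _ hf) (integrable_circle _ hf), ih, integral_dirac]

/-- The moments of the spectral measure are the normalized traces of the powers. -/
lemma integral_pow_spectralMeasure {N : ℕ} (V : Matrix.unitaryGroup (Fin N) ℂ) (n : ℕ) :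
    ∫ z : Circle, (z : ℂ) ^ n ∂spectralMeasure V =
      ((V : Matrix (Fin N) (Fin N) ℂ) ^ n).trace / N := by
  obtain ⟨s, hs⟩ := exists_circle_roots V
  rw [spectralMeasure_eq V hs, integral_smul_measure,
    integral_multiset_sum_dirac s (by fun_prop), trace_pow_eq_sum_roots, ← hs, Multiset.map_map]
  simp only [Function.comp_def, ENNReal.toReal_inv, ENNReal.toReal_natCast, Complex.real_smul]
  push_cast
  rw [div_eq_inv_mul]

lemma isProbabilityMeasure_spectralMeasure {N : ℕ} (hN : N ≠ 0)
    (V : Matrix.unitaryGroup (Fin N) ℂ) : IsProbabilityMeasure (spectralMeasure V) := by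
  obtain ⟨s, hs⟩ := exists_circle_roots V
  have hcard : s.card = N := by
    have := congrArg Multiset.card hs
    rwa [Multiset.card_map, IsAlgClosed.card_roots_eq_natDegree,
      Matrix.charpoly_natDegree_eq_dim, Fintype.card_fin] at this
  have hmass : ∀ s : Multiset Circle, (s.map Measure.dirac).sum Set.univ = (s.card : ℝ≥0∞) := by
    intro s
    induction s using Multiset.induction_on with
    | empty => simp
    | cons a s ih =>
      rw [Multiset.map_cons, Multiset.sum_cons, Measure.add_apply, ih, measure_univ,
        Multiset.card_cons]
      push_cast
      ring
  constructor
  rw [spectralMeasure_eq V hs, Measure.smul_apply, hmass, hcard, smul_eq_mul]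
  exact ENNReal.inv_mul_cancel (by exact_mod_cast hN) (ENNReal.natCast_ne_top N)

/-! ### The Laplacian of trace functions -/

/-- Two double sums agree if their terms agree after symmetrization. The basis `skewBasis` assigns
the two elements belonging to a pair `{j, k}` to `(j, k)` and `(k, j)`. -/
lemma Finset.sum_sum_eq_of_symm {ι : Type*} [Fintype ι] {E : Type*} [AddCommGroup E] [Module ℂ E]
    {f g : ι → ι → E} (h : ∀ j k, f j k + f k j = g j k + g k j) :
    ∑ j, ∑ k, f j k = ∑ j, ∑ k, g j k := by
  have h1 : ∀ f : ι → ι → E, ∑ j, ∑ k, (f j k + f k j) = (2 : ℂ) • ∑ j, ∑ k, f j k := by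
    intro f
    simp only [Finset.sum_add_distrib]
    rw [Finset.sum_comm (f := fun j k => f k j), two_smul]
  have h2 : (2 : ℂ) • ∑ j, ∑ k, f j k = (2 : ℂ) • ∑ j, ∑ k, g j k := by
    rw [← h1, ← h1]
    simp only [h]
  exact smul_right_injective E two_ne_zero h2

lemma skewBasis_of_lt {N : ℕ} {j k : Fin N} (h : j < k) : skewBasis N j k =
    (1 / (√(2 * N : ℝ) : ℂ)) • (Matrix.single j k 1 - Matrix.single k j 1) := by
  rw [skewBasis, if_neg h.ne, if_pos h]

lemma skewBasis_of_gt {N : ℕ} {j k : Fin N} (h : j < k) : skewBasis N k j =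
    (Complex.I / (√(2 * N : ℝ) : ℂ)) • (Matrix.single k j 1 + Matrix.single j k 1) := by
  rw [skewBasis, if_neg h.ne', if_neg h.asymm]

lemma skewBasis_self {N : ℕ} (j : Fin N) : skewBasis N j j =
    (Complex.I / (√(N : ℝ) : ℂ)) • Matrix.single j j 1 := by
  rw [skewBasis, if_pos rfl]

lemma complex_sqrt_sq {x : ℝ} (hx : 0 ≤ x) : ((√x : ℝ) : ℂ) ^ 2 = (x : ℂ) := by
  rw [← Complex.ofReal_pow, Real.sq_sqrt hx]

lemma single_mul_mul_single' {N : ℕ} (B : Matrix (Fin N) (Fin N) ℂ) (a b c d : Fin N) :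
    Matrix.single a b (1 : ℂ) * B * Matrix.single c d 1 = Matrix.single a d (B b c) := by
  simp

lemma sum_single_mul_diag {N : ℕ} (B : Matrix (Fin N) (Fin N) ℂ) :
    ∑ j, ∑ k, (-(1 / (N : ℂ))) • Matrix.single j j (B k k) =
      (-(B.trace / N)) • (1 : Matrix (Fin N) (Fin N) ℂ) := by
  simp only [← Finset.smul_sum]
  ext a b
  simp only [Matrix.smul_apply, Matrix.sum_apply, smul_eq_mul, Matrix.single_apply,
    Matrix.one_apply]
  by_cases hab : a = b
  · subst hab
    rw [Finset.sum_eq_single a]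
    · simp [Matrix.trace]
      ring
    · intro j _ hj
      simp [hj]
    · simp
  · rw [if_neg hab, mul_zero, Finset.sum_eq_zero, mul_zero]
    intro j _
    refine Finset.sum_eq_zero fun k _ => if_neg ?_
    rintro ⟨rfl, rfl⟩
    exact hab rfl

/-- The "magic formula" `∑_ξ ξ B ξ = -(tr B / N) 1` for the sum over an orthonormal basis of the
skew-Hermitian matrices. -/
lemma sum_skewBasis_mul_mul {N : ℕ} (hN : N ≠ 0) (B : Matrix (Fin N) (Fin N) ℂ) :
    ∑ j, ∑ k, skewBasis N j k * B * skewBasis N j k =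
      (-(B.trace / N)) • (1 : Matrix (Fin N) (Fin N) ℂ) := by
  have hN' : (N : ℂ) ≠ 0 := by exact_mod_cast hN
  rw [← sum_single_mul_diag]
  have hlt : ∀ j k : Fin N, j < k →
      skewBasis N j k * B * skewBasis N j k + skewBasis N k j * B * skewBasis N k j =
        (-(1 / (N : ℂ))) • Matrix.single j j (B k k) +
          (-(1 / (N : ℂ))) • Matrix.single k k (B j j) := by
    intro j k h
    have hs := complex_sqrt_sq (x := 2 * N) (by positivity)
    push_cast at hs
    have hs0 : ((√(2 * N : ℝ) : ℝ) : ℂ) ≠ 0 := by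
      intro h0
      rw [h0] at hs
      simp [hN'] at hs
    rw [skewBasis_of_lt h, skewBasis_of_gt h]
    simp only [Matrix.smul_mul, Matrix.mul_smul, Matrix.sub_mul, Matrix.mul_sub,
      Matrix.add_mul, Matrix.mul_add, single_mul_mul_single', smul_sub, smul_add, smul_smul]
    have e1 : (1 / ((√(2 * N : ℝ) : ℝ) : ℂ)) * (1 / ((√(2 * N : ℝ) : ℝ) : ℂ)) =
        1 / (2 * N) := by rw [← hs]; field_simp
    have e2 : (Complex.I / ((√(2 * N : ℝ) : ℝ) : ℂ)) * (Complex.I / ((√(2 * N : ℝ) : ℝ) : ℂ)) =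
        -(1 / (2 * N)) := by
      rw [← hs]
      field_simp
      rw [Complex.I_sq]
    rw [e1, e2]
    have e3 : (1 / (N : ℂ)) = 1 / (2 * N) + 1 / (2 * N) := by field_simp; ring
    rw [e3]
    module
  have hall : ∀ j k : Fin N,
      skewBasis N j k * B * skewBasis N j k + skewBasis N k j * B * skewBasis N k j =
        (-(1 / (N : ℂ))) • Matrix.single j j (B k k) +
          (-(1 / (N : ℂ))) • Matrix.single k k (B j j) := by
    intro j k
    rcases lt_trichotomy j k with h | rfl | h
    · exact hlt j k h
    · have hs := complex_sqrt_sq (x := N) (by positivity)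
      push_cast at hs
      have hs0 : ((√(N : ℝ) : ℝ) : ℂ) ≠ 0 := by
        intro h0
        rw [h0] at hs
        exact hN' (by simpa using hs.symm)
      rw [skewBasis_self]
      simp only [Matrix.smul_mul, Matrix.mul_smul, smul_smul, single_mul_mul_single']
      have e2 : (Complex.I / ((√(N : ℝ) : ℝ) : ℂ)) * (Complex.I / ((√(N : ℝ) : ℝ) : ℂ)) =
          -(1 / (N : ℂ)) := by
        rw [← hs]
        field_simp
        rw [Complex.I_sq]
      rw [e2]
    · rw [add_comm, hlt k j h, add_comm]
  exact Finset.sum_sum_eq_of_symm hall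

lemma trace_mul_single {N : ℕ} (A : Matrix (Fin N) (Fin N) ℂ) (j k : Fin N) :
    (A * Matrix.single j k (1 : ℂ)).trace = A k j := by
  rw [Matrix.trace_mul_comm, Matrix.trace_single_mul, one_smul]

/-- **Parseval's identity** for the coefficients of a matrix in the basis `skewBasis`. -/
lemma sum_normSq_trace_mul_skewBasis {N : ℕ} (hN : N ≠ 0) (A : Matrix (Fin N) (Fin N) ℂ) :
    ∑ j, ∑ k, ((Complex.normSq (A * skewBasis N j k).trace : ℝ) : ℂ) =
      (1 / (N : ℂ)) * (A * A.conjTranspose).trace := by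
  have hN' : (N : ℂ) ≠ 0 := by exact_mod_cast hN
  have hr : (1 / (N : ℂ)) * (A * A.conjTranspose).trace =
      ∑ j, ∑ k, (1 / (N : ℂ)) * ((Complex.normSq (A j k) : ℝ) : ℂ) := by
    simp only [Matrix.trace, Matrix.diag, Matrix.mul_apply, Matrix.conjTranspose_apply,
      Finset.mul_sum]
    refine Finset.sum_congr rfl fun j _ => Finset.sum_congr rfl fun k _ => ?_
    rw [← Complex.mul_conj]
    rfl
  rw [hr]
  have hlt : ∀ j k : Fin N, j < k →
      ((Complex.normSq (A * skewBasis N j k).trace : ℝ) : ℂ) +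
        ((Complex.normSq (A * skewBasis N k j).trace : ℝ) : ℂ) =
        (1 / (N : ℂ)) * ((Complex.normSq (A j k) : ℝ) : ℂ) +
          (1 / (N : ℂ)) * ((Complex.normSq (A k j) : ℝ) : ℂ) := by
    intro j k h
    rw [skewBasis_of_lt h, skewBasis_of_gt h]
    simp only [Matrix.mul_smul, Matrix.trace_smul, Matrix.mul_sub, Matrix.mul_add,
      Matrix.trace_sub, Matrix.trace_add, trace_mul_single, smul_eq_mul, map_mul, map_div₀,
      Complex.normSq_one, Complex.normSq_I, Complex.normSq_ofReal]
    rw [Real.mul_self_sqrt (by positivity)]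
    have e : Complex.normSq (A k j - A j k) + Complex.normSq (A j k + A k j) =
        2 * (Complex.normSq (A j k) + Complex.normSq (A k j)) := by
      simp only [Complex.normSq_apply, Complex.sub_re, Complex.sub_im, Complex.add_re,
        Complex.add_im]
      ring
    have e' := congrArg (fun x : ℝ => (x : ℂ)) e
    push_cast at e' ⊢
    field_simp
    linear_combination e'
  have hall : ∀ j k : Fin N,
      ((Complex.normSq (A * skewBasis N j k).trace : ℝ) : ℂ) +
        ((Complex.normSq (A * skewBasis N k j).trace : ℝ) : ℂ) =
        (1 / (N : ℂ)) * ((Complex.normSq (A j k) : ℝ) : ℂ) +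
          (1 / (N : ℂ)) * ((Complex.normSq (A k j) : ℝ) : ℂ) := by
    intro j k
    rcases lt_trichotomy j k with h | rfl | h
    · exact hlt j k h
    · rw [skewBasis_self]
      simp only [Matrix.mul_smul, Matrix.trace_smul, trace_mul_single, smul_eq_mul, map_mul,
        map_div₀, Complex.normSq_I, Complex.normSq_ofReal]
      rw [Real.mul_self_sqrt (by positivity)]
      push_cast
      ring
    · rw [add_comm, hlt k j h, add_comm]
  exact Finset.sum_sum_eq_of_symm hall

/-- The normalized trace of the `n`-th power of a matrix. -/
noncomputable def powTrace {N : ℕ} (n : ℕ) (A : Matrix (Fin N) (Fin N) ℂ) : ℂ :=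
  (A ^ n).trace / N

/-- The Laplacian of `powTrace n`, restricted to the unitary group. -/
noncomputable def powTraceLaplacian {N : ℕ} (n : ℕ) (A : Matrix (Fin N) (Fin N) ℂ) : ℂ :=
  -(n : ℂ) * ∑ i ∈ Finset.range n, powTrace (i + 1) A * powTrace (n - 1 - i) A

open scoped Matrix.Norms.Operator in
lemma hasDerivAt_mul_exp {N : ℕ} (A ξ : Matrix (Fin N) (Fin N) ℂ) (s : ℝ) (a b : Fin N) :
    HasDerivAt (fun s : ℝ => (A * NormedSpace.exp (s • ξ)) a b)
      ((A * NormedSpace.exp (s • ξ) * ξ) a b) s := by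
  have h := (hasDerivAt_exp_smul_const (𝕂 := ℝ) ξ s).const_mul A
  rw [← Matrix.mul_assoc] at h
  exact (LinearMap.toContinuousLinearMap
    (Matrix.entryLinearMap ℝ ℂ a b)).hasFDerivAt.comp_hasDerivAt s h

/-- The product rule for matrix-valued functions, in terms of entries. -/
lemma hasDerivAt_matrix_mul {N : ℕ} {V W : ℝ → Matrix (Fin N) (Fin N) ℂ}
    {V' W' : Matrix (Fin N) (Fin N) ℂ} {s : ℝ}
    (hV : ∀ a b, HasDerivAt (fun s => V s a b) (V' a b) s)
    (hW : ∀ a b, HasDerivAt (fun s => W s a b) (W' a b) s) (a b : Fin N) :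
    HasDerivAt (fun s => (V s * W s) a b) ((V' * W s + V s * W') a b) s := by
  simp only [Matrix.mul_apply, Matrix.add_apply, ← Finset.sum_add_distrib]
  exact HasDerivAt.fun_sum fun c _ => (hV a c).mul (hW c b)

lemma sum_range_pow_mul_pow_succ {R : Type*} [Ring R] (V ξ : R) (n : ℕ) :
    (∑ i ∈ Finset.range n, V ^ (i + 1) * ξ * V ^ (n - 1 - i)) * V + V ^ n * (V * ξ) =
      ∑ i ∈ Finset.range (n + 1), V ^ (i + 1) * ξ * V ^ (n + 1 - 1 - i) := by
  rw [Finset.sum_range_succ, Finset.sum_mul, Nat.add_sub_cancel, Nat.sub_self, pow_zero,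
    mul_one, pow_succ, mul_assoc]
  congr 1
  refine Finset.sum_congr rfl fun i hi => ?_
  have hi' := Finset.mem_range.1 hi
  have e2 : n - i = n - 1 - i + 1 := by omega
  rw [e2, pow_succ V (n - 1 - i), mul_assoc]

lemma hasDerivAt_matrix_pow {N : ℕ} {V : ℝ → Matrix (Fin N) (Fin N) ℂ}
    {ξ : Matrix (Fin N) (Fin N) ℂ} {s : ℝ}
    (hV : ∀ a b, HasDerivAt (fun s => V s a b) ((V s * ξ) a b) s) (n : ℕ) :
    ∀ a b : Fin N, HasDerivAt (fun s => (V s ^ n) a b)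
      ((∑ i ∈ Finset.range n, V s ^ (i + 1) * ξ * V s ^ (n - 1 - i)) a b) s := by
  induction n with
  | zero =>
    intro a b
    exact hasDerivAt_const s ((1 : Matrix (Fin N) (Fin N) ℂ) a b)
  | succ n ih =>
    intro a b
    have h := hasDerivAt_matrix_mul (V := fun s => V s ^ n) ih hV a b
    have e : (fun s => (V s ^ (n + 1)) a b) = fun s => (V s ^ n * V s) a b := by
      funext u
      rw [pow_succ]
    rw [e]
    exact h.congr_deriv (congrFun (congrFun (sum_range_pow_mul_pow_succ (V s) ξ n) a) b)

lemma hasDerivAt_matrix_trace {N : ℕ} {V : ℝ → Matrix (Fin N) (Fin N) ℂ}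
    {V' : Matrix (Fin N) (Fin N) ℂ} {s : ℝ}
    (hV : ∀ a b, HasDerivAt (fun s => V s a b) (V' a b) s) :
    HasDerivAt (fun s => (V s).trace) V'.trace s := by
  simp only [Matrix.trace, Matrix.diag]
  exact HasDerivAt.fun_sum fun a _ => hV a a

lemma hasDerivAt_powTrace {N : ℕ} (A ξ : Matrix (Fin N) (Fin N) ℂ) (n : ℕ) (s : ℝ) :
    HasDerivAt (fun s : ℝ => powTrace n (A * NormedSpace.exp (s • ξ)))
      ((n : ℂ) / N * ((A * NormedSpace.exp (s • ξ)) ^ n * ξ).trace) s := by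
  have h := (hasDerivAt_matrix_trace (hasDerivAt_matrix_pow (hasDerivAt_mul_exp A ξ s) n)).div_const (N : ℂ)
  refine h.congr_deriv ?_
  set V := A * NormedSpace.exp (s • ξ)
  rw [Matrix.trace_sum, Finset.sum_congr rfl (g := fun _ => (V ^ n * ξ).trace)]
  · simp
    ring
  · intro i hi
    have hi' := Finset.mem_range.1 hi
    rw [Matrix.trace_mul_comm, ← Matrix.mul_assoc, ← pow_add]
    congr 3
    omega

lemma hasDerivAt_trace_pow_mul {N : ℕ} (A ξ : Matrix (Fin N) (Fin N) ℂ) (n : ℕ) :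
    HasDerivAt (fun s : ℝ => (n : ℂ) / N * ((A * NormedSpace.exp (s • ξ)) ^ n * ξ).trace)
      ((n : ℂ) / N * ∑ i ∈ Finset.range n, (A ^ (i + 1) * (ξ * A ^ (n - 1 - i) * ξ)).trace) 0 := by
  have hξ : ∀ a b, HasDerivAt (fun _ : ℝ => ξ a b) ((0 : Matrix (Fin N) (Fin N) ℂ) a b) 0 :=
    fun a b => hasDerivAt_const _ _
  have h := (hasDerivAt_matrix_trace (hasDerivAt_matrix_mul
    (hasDerivAt_matrix_pow (hasDerivAt_mul_exp A ξ 0) n) hξ)).const_mul ((n : ℂ) / N)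
  refine h.congr_deriv ?_
  rw [zero_smul, NormedSpace.exp_zero, mul_one, mul_zero, add_zero, Finset.sum_mul,
    Matrix.trace_sum]
  simp only [Matrix.mul_assoc]

lemma iteratedDeriv_two_eq {f f' : ℝ → ℝ} {f'' : ℝ} (h : ∀ s, HasDerivAt f (f' s) s)
    (h' : HasDerivAt f' f'' 0) : iteratedDeriv 2 f 0 = f'' := by
  have e : deriv f = f' := funext fun s => (h s).deriv
  rw [iteratedDeriv_succ, iteratedDeriv_one, e, h'.deriv]

/-- The second derivatives of `powTrace n`, summed over the basis. -/
lemma sum_second_deriv_powTrace {N : ℕ} (hN : N ≠ 0) (n : ℕ) (A : Matrix (Fin N) (Fin N) ℂ) :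
    ∑ j, ∑ k, (n : ℂ) / N * ∑ i ∈ Finset.range n,
      (A ^ (i + 1) * (skewBasis N j k * A ^ (n - 1 - i) * skewBasis N j k)).trace =
    powTraceLaplacian n A := by
  have e : ∀ j, ∑ k, (n : ℂ) / N * ∑ i ∈ Finset.range n,
      (A ^ (i + 1) * (skewBasis N j k * A ^ (n - 1 - i) * skewBasis N j k)).trace =
      (n : ℂ) / N * ∑ i ∈ Finset.range n, ∑ k,
        (A ^ (i + 1) * (skewBasis N j k * A ^ (n - 1 - i) * skewBasis N j k)).trace := by
    intro j
    rw [← Finset.mul_sum, Finset.sum_comm]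
  simp only [e]
  rw [← Finset.mul_sum, Finset.sum_comm]
  have e2 : ∀ i, ∑ j, ∑ k,
      (A ^ (i + 1) * (skewBasis N j k * A ^ (n - 1 - i) * skewBasis N j k)).trace =
      -((A ^ (n - 1 - i)).trace / N) * (A ^ (i + 1)).trace := by
    intro i
    simp only [← Matrix.trace_sum, ← Matrix.mul_sum]
    rw [sum_skewBasis_mul_mul hN, Matrix.mul_smul, Matrix.trace_smul, mul_one, smul_eq_mul]
  simp only [e2, powTraceLaplacian, powTrace]
  rw [Finset.mul_sum, Finset.mul_sum]
  refine Finset.sum_congr rfl fun i _ => ?_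
  ring

lemma unitaryLaplacian_re_powTrace {N : ℕ} (hN : N ≠ 0) (n : ℕ) (A : Matrix (Fin N) (Fin N) ℂ) :
    unitaryLaplacian N (fun x => (powTrace n (Matrix.of x)).re) A = (powTraceLaplacian n A).re := by
  rw [unitaryLaplacian, ← sum_second_deriv_powTrace hN n A, Complex.re_sum]
  refine Finset.sum_congr rfl fun j _ => ?_
  rw [Complex.re_sum]
  refine Finset.sum_congr rfl fun k _ => ?_
  have h1 := hasDerivAt_powTrace A (skewBasis N j k) n
  have h2 := hasDerivAt_trace_pow_mul A (skewBasis N j k) n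
  exact iteratedDeriv_two_eq (fun s => Complex.reCLM.hasFDerivAt.comp_hasDerivAt s (h1 s))
    (Complex.reCLM.hasFDerivAt.comp_hasDerivAt 0 h2)

lemma unitaryLaplacian_normSq_powTrace {N : ℕ} (hN : N ≠ 0) (n : ℕ)
    (A : Matrix (Fin N) (Fin N) ℂ) (hA : A ∈ Matrix.unitaryGroup (Fin N) ℂ) :
    unitaryLaplacian N (fun x => Complex.normSq (powTrace n (Matrix.of x))) A =
      2 * ((starRingEnd ℂ) (powTrace n A) * powTraceLaplacian n A).re + 2 * ((n : ℝ) / N) ^ 2 := by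
  have hN' : (N : ℂ) ≠ 0 := by exact_mod_cast hN
  have hterm : ∀ j k : Fin N, iteratedDeriv 2 (fun s : ℝ => Complex.normSq (powTrace n (Matrix.of
      (Matrix.of.symm (A * NormedSpace.exp (s • skewBasis N j k)))))) 0 =
      2 * ((starRingEnd ℂ) (powTrace n A) * ((n : ℂ) / N * ∑ i ∈ Finset.range n,
        (A ^ (i + 1) * (skewBasis N j k * A ^ (n - 1 - i) * skewBasis N j k)).trace)).re +
      2 * (((n : ℝ) / N) ^ 2 * Complex.normSq (A ^ n * skewBasis N j k).trace) := by
    intro j k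
    have h1 := hasDerivAt_powTrace A (skewBasis N j k) n
    have h2 := hasDerivAt_trace_pow_mul A (skewBasis N j k) n
    have r1 := fun s => Complex.reCLM.hasFDerivAt.comp_hasDerivAt s (h1 s)
    have i1 := fun s => Complex.imCLM.hasFDerivAt.comp_hasDerivAt s (h1 s)
    have r2 := Complex.reCLM.hasFDerivAt.comp_hasDerivAt 0 h2
    have i2 := Complex.imCLM.hasFDerivAt.comp_hasDerivAt 0 h2
    refine (iteratedDeriv_two_eq (fun s => ((r1 s).mul (r1 s)).add ((i1 s).mul (i1 s)))
      ((((r2.mul (r1 0)).add ((r1 0).mul r2))).add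
        ((i2.mul (i1 0)).add ((i1 0).mul i2)))).trans ?_
    have hns : Complex.normSq ((n : ℂ) / N * (A ^ n * skewBasis N j k).trace) =
        ((n : ℝ) / N) ^ 2 * Complex.normSq (A ^ n * skewBasis N j k).trace := by
      rw [map_mul, map_div₀, Complex.normSq_natCast, Complex.normSq_natCast]
      ring
    rw [← hns]
    simp only [Function.comp, zero_smul, NormedSpace.exp_zero, mul_one, Complex.reCLM_apply,
      Complex.imCLM_apply]
    generalize (n : ℂ) / N * ∑ i ∈ Finset.range n,
      (A ^ (i + 1) * (skewBasis N j k * A ^ (n - 1 - i) * skewBasis N j k)).trace = w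
    generalize (n : ℂ) / N * (A ^ n * skewBasis N j k).trace = v
    rw [Complex.normSq_apply, Complex.mul_re, Complex.conj_re, Complex.conj_im]
    ring
  rw [unitaryLaplacian]
  simp only [hterm, Finset.sum_add_distrib, ← Finset.mul_sum]
  congr 1
  · rw [← sum_second_deriv_powTrace hN n A]
    simp only [Finset.mul_sum, Complex.re_sum]
  · have hP := sum_normSq_trace_mul_skewBasis hN (A ^ n)
    have hu : A ^ n * (A ^ n).conjTranspose = 1 :=
      Matrix.mem_unitaryGroup_iff.1 (pow_mem hA n)
    rw [hu, Matrix.trace_one, Fintype.card_fin, one_div_mul_cancel hN'] at hP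
    have hP' : ∑ j, ∑ k, Complex.normSq (A ^ n * skewBasis N j k).trace = 1 := by
      exact_mod_cast hP
    rw [hP', mul_one]

lemma contDiff_pow_apply {N : ℕ} (n : ℕ) (a b : Fin N) :
    ContDiff ℝ (⊤ : ℕ∞) fun x : Fin N → Fin N → ℂ => ((Matrix.of x) ^ n) a b := by
  induction n generalizing a b with
  | zero => simpa using contDiff_const
  | succ n ih =>
    simp only [pow_succ, Matrix.mul_apply, Matrix.of_apply]
    refine ContDiff.sum fun c _ => (ih a c).mul ?_
    exact contDiff_apply_apply ℝ ℂ c b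

lemma contDiff_powTrace {N : ℕ} (n : ℕ) :
    ContDiff ℝ (⊤ : ℕ∞) fun x : Fin N → Fin N → ℂ => powTrace n (Matrix.of x) := by
  simp only [powTrace, Matrix.trace, Matrix.diag]
  exact (ContDiff.sum fun a _ => contDiff_pow_apply n a a).div_const _

lemma contDiff_re_powTrace {N : ℕ} (n : ℕ) :
    ContDiff ℝ (⊤ : ℕ∞) fun x : Fin N → Fin N → ℂ => (powTrace n (Matrix.of x)).re :=
  Complex.reCLM.contDiff.comp (contDiff_powTrace n)

lemma contDiff_normSq_powTrace {N : ℕ} (n : ℕ) :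
    ContDiff ℝ (⊤ : ℕ∞) fun x : Fin N → Fin N → ℂ =>
      Complex.normSq (powTrace n (Matrix.of x)) := by
  simp only [Complex.normSq_apply]
  have h1 := contDiff_re_powTrace (N := N) n
  have h2 : ContDiff ℝ (⊤ : ℕ∞) fun x : Fin N → Fin N → ℂ => (powTrace n (Matrix.of x)).im :=
    Complex.imCLM.contDiff.comp (contDiff_powTrace n)
  exact (h1.mul h1).add (h2.mul h2)

/-! ### Expectations along unitary Brownian motion -/

lemma continuous_powTrace {N : ℕ} (n : ℕ) :
    Continuous fun V : Matrix.unitaryGroup (Fin N) ℂ => powTrace n (V : Matrix (Fin N) (Fin N) ℂ) := by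
  unfold powTrace
  exact ((continuous_subtype_val.pow n).matrix_trace).div_const _

lemma continuous_powTraceLaplacian {N : ℕ} (n : ℕ) :
    Continuous fun V : Matrix.unitaryGroup (Fin N) ℂ =>
      powTraceLaplacian n (V : Matrix (Fin N) (Fin N) ℂ) := by
  unfold powTraceLaplacian
  exact continuous_const.mul (continuous_finsetSum _ fun i _ =>
    (continuous_powTrace _).mul (continuous_powTrace _))

lemma norm_powTrace_le_one {N : ℕ} (n : ℕ) (V : Matrix.unitaryGroup (Fin N) ℂ) :
    ‖powTrace n (V : Matrix (Fin N) (Fin N) ℂ)‖ ≤ 1 := by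
  rw [powTrace, norm_div, Complex.norm_natCast]
  refine div_le_one_of_le₀ ?_ (by positivity)
  refine (norm_sum_le _ _).trans ?_
  calc ∑ i : Fin N, ‖((V : Matrix (Fin N) (Fin N) ℂ) ^ n).diag i‖ ≤ ∑ _i : Fin N, (1 : ℝ) :=
        Finset.sum_le_sum fun i _ => entry_norm_bound_of_unitary (pow_mem V.2 n) i i
    _ = N := by simp

lemma norm_powTraceLaplacian_le {N : ℕ} (n : ℕ) (V : Matrix.unitaryGroup (Fin N) ℂ) :
    ‖powTraceLaplacian n (V : Matrix (Fin N) (Fin N) ℂ)‖ ≤ (n : ℝ) ^ 2 := by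
  rw [powTraceLaplacian, norm_mul, norm_neg, Complex.norm_natCast, sq]
  gcongr
  refine (norm_sum_le _ _).trans ?_
  calc _ ≤ ∑ _i ∈ Finset.range n, (1 : ℝ) := Finset.sum_le_sum fun i _ => by
        rw [norm_mul]
        exact mul_le_one₀ (norm_powTrace_le_one _ V) (norm_nonneg _) (norm_powTrace_le_one _ V)
    _ = n := by simp

/-- A Brownian motion agrees almost surely with a process all of whose paths are continuous and
issued from the identity. -/
lemma IsUnitaryBrownianMotion.exists_continuous_modification {Ω : Type*} [MeasurableSpace Ω]
    {P : Measure Ω} {N : ℕ} {U : ℝ≥0 → Ω → Matrix.unitaryGroup (Fin N) ℂ}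
    (hU : IsUnitaryBrownianMotion N U P) :
    ∃ W : ℝ≥0 → Ω → Matrix.unitaryGroup (Fin N) ℂ, (∀ ω, W 0 ω = 1) ∧
      (∀ ω, Continuous fun t => W t ω) ∧ (∀ t, StronglyMeasurable (W t)) ∧
      ∀ᵐ ω ∂P, ∀ t, W t ω = U t ω := by
  classical
  obtain ⟨ℱ, hadp, -⟩ := hU.martingale_problem
  have hgood : ∀ᵐ ω ∂P, U 0 ω = 1 ∧ Continuous fun t => U t ω :=
    hU.start.and hU.continuous_paths
  obtain ⟨B, hBsub, hB, hB0⟩ := exists_measurable_superset_of_null (ae_iff.1 hgood)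
  have hG : ∀ ω, ω ∉ B → U 0 ω = 1 ∧ Continuous fun t => U t ω := by
    intro ω hω
    by_contra h
    exact hω (hBsub h)
  refine ⟨fun t ω => if ω ∈ B then 1 else U t ω, fun ω => ?_, fun ω => ?_, fun t => ?_, ?_⟩
  · by_cases h : ω ∈ B
    · simp [h]
    · simp [h, (hG ω h).1]
  · by_cases h : ω ∈ B
    · simpa [h] using continuous_const
    · simpa [h] using (hG ω h).2
  · exact StronglyMeasurable.ite hB stronglyMeasurable_const ((hadp t).mono (ℱ.le t))
  · have hnot : ∀ᵐ ω ∂P, ω ∉ B := measure_eq_zero_iff_ae_notMem.1 hB0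
    filter_upwards [hnot] with ω hω t
    simp [hω]

section Dynkin

variable {Ω : Type*} [MeasurableSpace Ω] {P : Measure Ω} [IsProbabilityMeasure P] {N : ℕ}
  {U W : ℝ≥0 → Ω → Matrix.unitaryGroup (Fin N) ℂ}

lemma integrable_comp_process (hWm : ∀ t, StronglyMeasurable (W t))
    {g : Matrix.unitaryGroup (Fin N) ℂ → ℝ} (hg : Continuous g) {C : ℝ} (hgC : ∀ V, |g V| ≤ C)
    (t : ℝ≥0) : Integrable (fun ω => g (W t ω)) P :=
  Integrable.of_bound (hg.comp_stronglyMeasurable (hWm t)).aestronglyMeasurable C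
    (ae_of_all _ fun _ => hgC _)

lemma continuous_integral_process (hWc : ∀ ω, Continuous fun t => W t ω)
    (hWm : ∀ t, StronglyMeasurable (W t)) {g : Matrix.unitaryGroup (Fin N) ℂ → ℝ}
    (hg : Continuous g) {C : ℝ} (hgC : ∀ V, |g V| ≤ C) :
    Continuous fun s : ℝ => ∫ ω, g (W s.toNNReal ω) ∂P :=
  continuous_of_dominated (bound := fun _ => C)
    (fun _ => (hg.comp_stronglyMeasurable (hWm _)).aestronglyMeasurable)
    (fun _ => ae_of_all _ fun _ => hgC _) (integrable_const C)
    (ae_of_all _ fun ω => hg.comp ((hWc ω).comp continuous_real_toNNReal))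

/-- **Dynkin's formula** for a solution of the martingale problem. -/
lemma IsUnitaryBrownianMotion.integral_eq (hU : IsUnitaryBrownianMotion N U P)
    (hW0 : ∀ ω, W 0 ω = 1) (hWc : ∀ ω, Continuous fun t => W t ω)
    (hWm : ∀ t, StronglyMeasurable (W t)) (hWU : ∀ᵐ ω ∂P, ∀ t, W t ω = U t ω)
    {f : (Fin N → Fin N → ℂ) → ℝ} (hf : ContDiff ℝ (⊤ : ℕ∞) f)
    {F g : Matrix.unitaryGroup (Fin N) ℂ → ℝ}
    (hF : ∀ V : Matrix.unitaryGroup (Fin N) ℂ, f (Matrix.of.symm (V : Matrix (Fin N) (Fin N) ℂ)) = F V) (hFc : Continuous F)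
    (hg : Continuous g) (hfg : ∀ V : Matrix.unitaryGroup (Fin N) ℂ,
      (1 / 2) * unitaryLaplacian N f (V : Matrix (Fin N) (Fin N) ℂ) = g V)
    {C : ℝ} (hFC : ∀ V, |F V| ≤ C) (hgC : ∀ V, |g V| ≤ C) (t : ℝ≥0) :
    ∫ ω, F (W t ω) ∂P = F 1 + ∫ s in (0 : ℝ)..t, ∫ ω, g (W s.toNNReal ω) ∂P := by
  obtain ⟨ℱ, -, hmart⟩ := hU.martingale_problem
  have hM := hmart f hf
  have h0 := hM.setIntegral_eq (zero_le (a := t)) MeasurableSet.univ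
  simp only [Measure.restrict_univ] at h0
  have hrep : ∀ t : ℝ≥0, ∫ ω, (f (Matrix.of.symm (U t ω : Matrix (Fin N) (Fin N) ℂ)) -
      ∫ s in (0 : ℝ)..t, (1 / 2) * unitaryLaplacian N f (U s.toNNReal ω)) ∂P =
      ∫ ω, (F (W t ω) - ∫ s in (0 : ℝ)..t, g (W s.toNNReal ω)) ∂P := by
    intro t
    refine integral_congr_ae ?_
    filter_upwards [hWU] with ω hω
    simp only [hF, hfg, hω]
  rw [hrep, hrep] at h0
  simp only [NNReal.coe_zero, intervalIntegral.integral_same, sub_zero, hW0, integral_const,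
    probReal_univ, one_smul] at h0
  have hjoint : StronglyMeasurable (Function.uncurry fun (s : ℝ) ω => g (W s.toNNReal ω)) :=
    stronglyMeasurable_uncurry_of_continuous_of_stronglyMeasurable
      (fun ω => hg.comp ((hWc ω).comp continuous_real_toNNReal))
      (fun s => hg.comp_stronglyMeasurable (hWm _))
  have hint : Integrable (Function.uncurry fun (s : ℝ) ω => g (W s.toNNReal ω))
      ((volume.restrict (Set.Ioc (0 : ℝ) t)).prod P) :=
    Integrable.of_bound hjoint.aestronglyMeasurable C (ae_of_all _ fun p => hgC _)
  have hswap : ∫ ω, (∫ s in (0 : ℝ)..t, g (W s.toNNReal ω)) ∂P =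
      ∫ s in (0 : ℝ)..t, ∫ ω, g (W s.toNNReal ω) ∂P := by
    simp only [intervalIntegral.integral_of_le (NNReal.coe_nonneg t)]
    exact (integral_integral_swap hint).symm
  have hint2 : Integrable (fun ω => ∫ s in (0 : ℝ)..t, g (W s.toNNReal ω)) P := by
    simp only [intervalIntegral.integral_of_le (NNReal.coe_nonneg t)]
    exact hint.integral_prod_right
  rw [integral_sub (integrable_comp_process hWm hFc hFC t) hint2, hswap] at h0
  linarith

end Dynkin

/-! ### Concentration of the traces around the limiting moments -/

/-- The `n`-th moment of the limiting spectral measure at time `t`, with the value `1` at `n = 0`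
(where `bianeMoment` has the value `0`). -/
noncomputable def limitMoment (t : ℝ) (n : ℕ) : ℝ := if n = 0 then 1 else bianeMoment t n

lemma abs_limitMoment_le_one {t : ℝ} (ht : 0 ≤ t) (n : ℕ) : |limitMoment t n| ≤ 1 := by
  rw [limitMoment]
  split_ifs
  · simp
  · exact abs_bianeMoment_le_one ht n

lemma limitMoment_zero_left (n : ℕ) : limitMoment 0 n = 1 := by
  rw [limitMoment]
  split_ifs with h
  · rfl
  · exact bianeMoment_zero_left h

lemma hasDerivAt_limitMoment (m : ℕ) (t : ℝ) :
    HasDerivAt (fun s => limitMoment s (m + 1)) (-(((m + 1 : ℕ) : ℝ) / 2) *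
      ∑ i ∈ Finset.range (m + 1), limitMoment t (i + 1) * limitMoment t (m - i)) t := by
  have e : ∀ s k, limitMoment s (k + 1) = bianeMoment s (k + 1) := fun s k => if_neg k.succ_ne_zero
  have hL : ∑ i ∈ Finset.range (m + 1), limitMoment t (i + 1) * limitMoment t (m - i) =
      ∑ i ∈ Finset.range m, bianeMoment t (i + 1) * bianeMoment t (m - i) +
        bianeMoment t (m + 1) := by
    have h0 : limitMoment t 0 = 1 := if_pos rfl
    rw [Finset.sum_range_succ, Nat.sub_self, h0, mul_one, e]
    congr 1
    refine Finset.sum_congr rfl fun i hi => ?_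
    have hi' := Finset.mem_range.1 hi
    rw [e, limitMoment, if_neg (by omega)]
  have hR : ∑ x ∈ Finset.HasAntidiagonal.antidiagonal (m + 1),
      bianeMoment t x.1 * bianeMoment t x.2 =
      ∑ i ∈ Finset.range m, bianeMoment t (i + 1) * bianeMoment t (m - i) := by
    rw [Finset.Nat.sum_antidiagonal_eq_sum_range_succ_mk, Finset.sum_range_succ',
      Finset.sum_range_succ]
    simp only [bianeMoment_zero_right, Nat.sub_self, Nat.add_sub_add_right, zero_mul, mul_zero,
      add_zero]
  have h := hasDerivAt_bianeMoment (m + 1) t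
  rw [hR, add_comm (bianeMoment t (m + 1)), ← hL] at h
  simpa only [e] using h

/-- The drift of `|x_{m+1} - a_{m+1}|²` is controlled by the squared differences of lower order:
the term `i = m` is dissipative and absorbs the factor `x_{m+1} - a_{m+1}` of the others. -/
lemma drift_le {x : ℕ → ℂ} {a : ℕ → ℝ} (hx0 : x 0 = 1) (ha0 : a 0 = 1) (hx : ∀ k, ‖x k‖ ≤ 1)
    (ha : ∀ k, |a k| ≤ 1) (m : ℕ) :
    2 * (((starRingEnd ℂ) (x (m + 1)) - a (m + 1)) *
      ((1 / 2) * (-((m + 1 : ℕ) : ℂ) * ∑ i ∈ Finset.range (m + 1), x (i + 1) * x (m - i)) -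
        ((-(((m + 1 : ℕ) : ℝ) / 2) *
          ∑ i ∈ Finset.range (m + 1), a (i + 1) * a (m - i) : ℝ) : ℂ))).re ≤
      ((m + 1 : ℕ) : ℝ) ^ 2 * ∑ i ∈ Finset.range m,
        (‖x (i + 1) - a (i + 1)‖ ^ 2 + ‖x (m - i) - a (m - i)‖ ^ 2) := by
  set δ := x (m + 1) - a (m + 1) with hδ
  set e : ℕ → ℂ := fun i => x (i + 1) * x (m - i) - a (i + 1) * a (m - i) with he
  set y : ℕ → ℝ := fun k => ‖x k - a k‖ with hy
  set n : ℝ := ((m + 1 : ℕ) : ℝ) with hn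
  have hn0 : 0 ≤ n := by positivity
  have hmn : (m : ℝ) ≤ n := by rw [hn]; push_cast; linarith
  set E := ∑ i ∈ Finset.range m, e i with hE
  set S := ∑ i ∈ Finset.range m, (y (i + 1) + y (m - i)) with hS
  have hδc : (starRingEnd ℂ) (x (m + 1)) - a (m + 1) = (starRingEnd ℂ) δ := by
    rw [hδ, map_sub, Complex.conj_ofReal]
  have hsum : (1 / 2) * (-((m + 1 : ℕ) : ℂ) * ∑ i ∈ Finset.range (m + 1), x (i + 1) * x (m - i)) -
        ((-(n / 2) * ∑ i ∈ Finset.range (m + 1), a (i + 1) * a (m - i) : ℝ) : ℂ) =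
      ((-(n / 2) : ℝ) : ℂ) * (δ + E) := by
    rw [Finset.sum_range_succ, Finset.sum_range_succ, Nat.sub_self, hx0, ha0, hE, he,
      Finset.sum_sub_distrib]
    push_cast [hn]
    ring
  have hEle : ‖E‖ ≤ S := by
    refine (norm_sum_le _ _).trans (Finset.sum_le_sum fun i _ => ?_)
    have h1 : e i = (x (i + 1) - a (i + 1)) * x (m - i) + a (i + 1) * (x (m - i) - a (m - i)) := by
      rw [he]; ring
    rw [h1]
    refine (norm_add_le _ _).trans ?_
    rw [norm_mul, norm_mul, Complex.norm_real, Real.norm_eq_abs]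
    exact add_le_add (mul_le_of_le_one_right (norm_nonneg _) (hx _))
      (mul_le_of_le_one_left (norm_nonneg _) (ha _))
  have hS0 : 0 ≤ S := (norm_nonneg _).trans hEle
  have hS2 : S ^ 2 ≤ n * ∑ i ∈ Finset.range m, 2 * (y (i + 1) ^ 2 + y (m - i) ^ 2) := by
    have h := sq_sum_le_card_mul_sum_sq (s := Finset.range m) (f := fun i => y (i + 1) + y (m - i))
    rw [Finset.card_range] at h
    refine h.trans (mul_le_mul hmn (Finset.sum_le_sum fun i _ => ?_)
      (Finset.sum_nonneg fun i _ => by positivity) hn0)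
    nlinarith [sq_nonneg (y (i + 1) - y (m - i))]
  rw [hδc, hsum]
  have hre : 2 * ((starRingEnd ℂ) δ * (((-(n / 2) : ℝ) : ℂ) * (δ + E))).re =
      -n * (‖δ‖ ^ 2 + ((starRingEnd ℂ) δ * E).re) := by
    have h1 : (starRingEnd ℂ) δ * (((-(n / 2) : ℝ) : ℂ) * (δ + E)) =
        ((-(n / 2) : ℝ) : ℂ) * ((starRingEnd ℂ) δ * δ + (starRingEnd ℂ) δ * E) := by ring
    rw [h1, Complex.re_ofReal_mul, Complex.add_re, mul_comm ((starRingEnd ℂ) δ) δ, Complex.mul_conj,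
      Complex.ofReal_re, Complex.normSq_eq_norm_sq]
    ring
  rw [hre]
  have hb : -(‖δ‖ * S) ≤ ((starRingEnd ℂ) δ * E).re := by
    have h1 := (abs_le.1 (Complex.abs_re_le_norm ((starRingEnd ℂ) δ * E))).1
    rw [norm_mul, RCLike.norm_conj] at h1
    have h2 := mul_le_mul_of_nonneg_left hEle (norm_nonneg δ)
    linarith
  have hquad : -(S ^ 2 / 4) ≤ ‖δ‖ ^ 2 + ((starRingEnd ℂ) δ * E).re := by
    nlinarith [sq_nonneg (‖δ‖ - S / 2)]
  have h3 := mul_le_mul_of_nonneg_left hquad hn0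
  rw [← Finset.mul_sum] at hS2
  set Y := ∑ i ∈ Finset.range m, (y (i + 1) ^ 2 + y (m - i) ^ 2) with hY
  have hY0 : 0 ≤ Y := Finset.sum_nonneg fun i _ => by positivity
  have h4 := mul_le_mul_of_nonneg_left hS2 hn0
  have h5 : 0 ≤ n * n * Y := by positivity
  nlinarith

lemma powTrace_one {N : ℕ} (hN : N ≠ 0) (n : ℕ) :
    powTrace n ((1 : Matrix.unitaryGroup (Fin N) ℂ) : Matrix (Fin N) (Fin N) ℂ) = 1 := by
  have hN' : (N : ℂ) ≠ 0 := by exact_mod_cast hN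
  simp [powTrace, hN']

lemma powTrace_zero {N : ℕ} (hN : N ≠ 0) (V : Matrix (Fin N) (Fin N) ℂ) : powTrace 0 V = 1 := by
  have hN' : (N : ℂ) ≠ 0 := by exact_mod_cast hN
  simp [powTrace, hN']

lemma norm_sub_ofReal_sq (z : ℂ) (a : ℝ) :
    ‖z - a‖ ^ 2 = Complex.normSq z - 2 * a * z.re + a ^ 2 := by
  rw [Complex.sq_norm, Complex.normSq_apply, Complex.normSq_apply]
  simp
  ring

section Variance

variable {Ω : Type*} [MeasurableSpace Ω] {P : Measure Ω} [IsProbabilityMeasure P]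

lemma integral_sub_mul_add_const {f g : Ω → ℝ} (hf : Integrable f P) (hg : Integrable g P)
    (b d : ℝ) : ∫ ω, (f ω - b * g ω + d) ∂P = ∫ ω, f ω ∂P - b * ∫ ω, g ω ∂P + d := by
  rw [integral_add (f := fun ω => f ω - b * g ω) (hf.sub (hg.const_mul b)) (integrable_const d),
    integral_sub (g := fun ω => b * g ω) hf (hg.const_mul b), integral_const_mul, integral_const,
    probReal_univ, one_smul]

/-- One step of the induction for the variance bound: the derivative in time of
`E |X_{m+1} - m_{m+1}|²` is at most `(m + 1)² / N²` plus a multiple of the corresponding quantities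
of lower order. -/
lemma IsUnitaryBrownianMotion.integral_sq_le {N : ℕ} (hN : N ≠ 0)
    {U : ℝ≥0 → Ω → Matrix.unitaryGroup (Fin N) ℂ} (hU : IsUnitaryBrownianMotion N U P)
    (m : ℕ) {T : ℝ} {c : ℕ → ℝ}
    (hc : ∀ k ≤ m, ∀ t : ℝ≥0, (t : ℝ) ≤ T →
      ∫ ω, ‖powTrace k (U t ω : Matrix (Fin N) (Fin N) ℂ) - limitMoment t k‖ ^ 2 ∂P ≤
        c k / (N : ℝ) ^ 2) (t : ℝ≥0) (ht : (t : ℝ) ≤ T) :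
    ∫ ω, ‖powTrace (m + 1) (U t ω : Matrix (Fin N) (Fin N) ℂ) - limitMoment t (m + 1)‖ ^ 2 ∂P ≤
      ((m + 1 : ℕ) : ℝ) ^ 2 * (1 + ∑ i ∈ Finset.range m, (c (i + 1) + c (m - i))) / (N : ℝ) ^ 2 *
        t := by
  obtain ⟨W, hW0, hWc, hWm, hWU⟩ := hU.exists_continuous_modification
  have hUW : ∀ k, ∀ t : ℝ≥0,
      ∫ ω, ‖powTrace k (U t ω : Matrix (Fin N) (Fin N) ℂ) - limitMoment t k‖ ^ 2 ∂P =
      ∫ ω, ‖powTrace k (W t ω : Matrix (Fin N) (Fin N) ℂ) - limitMoment t k‖ ^ 2 ∂P := by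
    intro k t
    refine integral_congr_ae ?_
    filter_upwards [hWU] with ω hω
    rw [hω]
  simp only [hUW] at hc ⊢
  set n : ℕ := m + 1 with hn
  set κ : ℝ := ((n : ℝ) / N) ^ 2 with hκ
  have hκ0 : 0 ≤ κ := by positivity
  set K : ℝ := (n : ℝ) ^ 2 * (1 + ∑ i ∈ Finset.range m, (c (i + 1) + c (m - i))) / (N : ℝ) ^ 2
    with hK
  -- the two test functions, and their images under the generator
  let F₁ : Matrix.unitaryGroup (Fin N) ℂ → ℝ := fun V =>
    (powTrace n (V : Matrix (Fin N) (Fin N) ℂ)).re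
  let g₁ : Matrix.unitaryGroup (Fin N) ℂ → ℝ := fun V =>
    (1 / 2) * (powTraceLaplacian n (V : Matrix (Fin N) (Fin N) ℂ)).re
  let F₂ : Matrix.unitaryGroup (Fin N) ℂ → ℝ := fun V =>
    Complex.normSq (powTrace n (V : Matrix (Fin N) (Fin N) ℂ))
  let g₂ : Matrix.unitaryGroup (Fin N) ℂ → ℝ := fun V =>
    ((starRingEnd ℂ) (powTrace n (V : Matrix (Fin N) (Fin N) ℂ)) *
      powTraceLaplacian n (V : Matrix (Fin N) (Fin N) ℂ)).re + κ
  have hF₁c : Continuous F₁ := Complex.continuous_re.comp (continuous_powTrace n)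
  have hF₂c : Continuous F₂ := Complex.continuous_normSq.comp (continuous_powTrace n)
  have hg₁c : Continuous g₁ :=
    continuous_const.mul (Complex.continuous_re.comp (continuous_powTraceLaplacian n))
  have hg₂c : Continuous g₂ :=
    (Complex.continuous_re.comp ((Complex.continuous_conj.comp (continuous_powTrace n)).mul
      (continuous_powTraceLaplacian n))).add continuous_const
  set C : ℝ := 1 + (n : ℝ) ^ 2 + κ with hC
  have hn0 : (0 : ℝ) ≤ (n : ℝ) ^ 2 := by positivity
  have hF₁C : ∀ V, |F₁ V| ≤ C := fun V => by
    have h := (Complex.abs_re_le_norm _).trans (norm_powTrace_le_one n V)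
    change |(powTrace n (V : Matrix (Fin N) (Fin N) ℂ)).re| ≤ C
    linarith
  have hF₂C : ∀ V, |F₂ V| ≤ C := fun V => by
    have h := norm_powTrace_le_one n V
    change |Complex.normSq (powTrace n (V : Matrix (Fin N) (Fin N) ℂ))| ≤ C
    rw [abs_of_nonneg (Complex.normSq_nonneg _), ← Complex.sq_norm]
    nlinarith [norm_nonneg (powTrace n (V : Matrix (Fin N) (Fin N) ℂ))]
  have hg₁C : ∀ V, |g₁ V| ≤ C := fun V => by
    have h := (Complex.abs_re_le_norm _).trans (norm_powTraceLaplacian_le n V)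
    change |(1 / 2) * (powTraceLaplacian n (V : Matrix (Fin N) (Fin N) ℂ)).re| ≤ C
    rw [abs_mul, abs_of_pos (by norm_num : (0 : ℝ) < 1 / 2)]
    linarith
  have hg₂C : ∀ V, |g₂ V| ≤ C := fun V => by
    refine (abs_add_le _ _).trans ?_
    rw [abs_of_nonneg hκ0]
    have h := Complex.abs_re_le_norm ((starRingEnd ℂ) (powTrace n
      (V : Matrix (Fin N) (Fin N) ℂ)) * powTraceLaplacian n (V : Matrix (Fin N) (Fin N) ℂ))
    rw [norm_mul, RCLike.norm_conj] at h
    have h2 := mul_le_mul (norm_powTrace_le_one n V) (norm_powTraceLaplacian_le n V)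
      (norm_nonneg _) zero_le_one
    linarith
  have dyn₁ := fun t : ℝ≥0 => hU.integral_eq hW0 hWc hWm hWU (contDiff_re_powTrace n) (F := F₁)
    (g := g₁) (fun V => rfl) hF₁c hg₁c
    (fun V => by rw [unitaryLaplacian_re_powTrace hN]) hF₁C hg₁C t
  have dyn₂ := fun t : ℝ≥0 => hU.integral_eq hW0 hWc hWm hWU (contDiff_normSq_powTrace n) (F := F₂)
    (g := g₂) (fun V => rfl) hF₂c hg₂c
    (fun V => by
      rw [unitaryLaplacian_normSq_powTrace hN n _ V.2]
      change _ = _ + κ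
      ring) hF₂C hg₂C t
  have hγ₁ := continuous_integral_process (P := P) hWc hWm hg₁c hg₁C
  have hγ₂ := continuous_integral_process (P := P) hWc hWm hg₂c hg₂C
  set γ₁ : ℝ → ℝ := fun s => ∫ ω, g₁ (W s.toNNReal ω) ∂P with hγ₁def
  set γ₂ : ℝ → ℝ := fun s => ∫ ω, g₂ (W s.toNNReal ω) ∂P with hγ₂def
  let B₁ : ℝ → ℝ := fun t => F₁ 1 + ∫ s in (0 : ℝ)..t, γ₁ s
  let B₂ : ℝ → ℝ := fun t => F₂ 1 + ∫ s in (0 : ℝ)..t, γ₂ s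
  have hB₁ : ∀ t, HasDerivAt B₁ (γ₁ t) t := fun t =>
    ((hγ₁.integral_hasStrictDerivAt 0 t).hasDerivAt).const_add _
  have hB₂ : ∀ t, HasDerivAt B₂ (γ₂ t) t := fun t =>
    ((hγ₂.integral_hasStrictDerivAt 0 t).hasDerivAt).const_add _
  let a : ℝ → ℝ := fun t => limitMoment t n
  let a' : ℝ → ℝ := fun t => -((n : ℝ) / 2) *
      ∑ i ∈ Finset.range (m + 1), limitMoment t (i + 1) * limitMoment t (m - i)
  have ha : ∀ t, HasDerivAt a (a' t) t := fun t => hasDerivAt_limitMoment m t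
  let D : ℝ → ℝ := fun t => B₂ t - 2 * a t * B₁ t + a t ^ 2
  let D' : ℝ → ℝ := fun t => γ₂ t - 2 * (a' t * B₁ t + a t * γ₁ t) + 2 * a t * a' t
  have hD : ∀ t, HasDerivAt D (D' t) t := fun t => by
    refine (((hB₂ t).sub (((ha t).const_mul 2).mul (hB₁ t))).add ((ha t).pow 2)).congr_deriv ?_
    simp only [D', Nat.cast_ofNat]
    ring
  have hDeq : ∀ t : ℝ≥0, ∫ ω, ‖powTrace n (W t ω : Matrix (Fin N) (Fin N) ℂ) -
      limitMoment t n‖ ^ 2 ∂P = D t := by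
    intro t
    have e1 : B₁ t = ∫ ω, F₁ (W t ω) ∂P := (dyn₁ t).symm
    have e2 : B₂ t = ∫ ω, F₂ (W t ω) ∂P := (dyn₂ t).symm
    simp only [D, e1, e2, norm_sub_ofReal_sq]
    have i1 := integrable_comp_process (P := P) hWm hF₁c hF₁C t
    have i2 := integrable_comp_process (P := P) hWm hF₂c hF₂C t
    exact integral_sub_mul_add_const i2 i1 _ _
  have hint : ∀ k, ∀ s : ℝ≥0, Integrable (fun ω =>
      ‖powTrace k (W s ω : Matrix (Fin N) (Fin N) ℂ) - limitMoment s k‖ ^ 2) P := by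
    intro k s
    refine integrable_comp_process (P := P) hWm (g := fun V =>
      ‖powTrace k (V : Matrix (Fin N) (Fin N) ℂ) - limitMoment s k‖ ^ 2)
      (((continuous_powTrace k).sub continuous_const).norm.pow 2) (C := (1 + 1) ^ 2)
      (fun V => ?_) s
    rw [abs_of_nonneg (by positivity)]
    have h := norm_sub_le (powTrace k (V : Matrix (Fin N) (Fin N) ℂ)) (limitMoment s k : ℂ)
    have h1 := norm_powTrace_le_one k V
    have h2 := abs_limitMoment_le_one s.2 k
    rw [Complex.norm_real, Real.norm_eq_abs] at h
    gcongr
    exact h.trans (add_le_add h1 h2)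
  have hD'le : ∀ s : ℝ, 0 ≤ s → s ≤ T → D' s ≤ K := by
    intro s hs0 hsT
    obtain ⟨s, rfl⟩ : ∃ r : ℝ≥0, (r : ℝ) = s := ⟨⟨s, hs0⟩, rfl⟩
    have e1 : B₁ s = ∫ ω, F₁ (W s ω) ∂P := (dyn₁ s).symm
    have i1 := integrable_comp_process (P := P) hWm hF₁c hF₁C s
    have j1 := integrable_comp_process (P := P) hWm hg₁c hg₁C s
    have j2 := integrable_comp_process (P := P) hWm hg₂c hg₂C s
    have hD'eq : D' s = ∫ ω, (g₂ (W s ω) - 2 * (a' s * F₁ (W s ω) + a s * g₁ (W s ω)) +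
        2 * a s * a' s) ∂P := by
      simp only [D', e1, hγ₁def, hγ₂def, Real.toNNReal_coe]
      have i3 : Integrable (fun ω => a' s * F₁ (W s ω) + a s * g₁ (W s ω)) P :=
        (i1.const_mul _).add (j1.const_mul _)
      rw [integral_sub_mul_add_const j2 i3, integral_add (i1.const_mul _) (j1.const_mul _),
        integral_const_mul (a' s), integral_const_mul (a s)]
    have hpt : ∀ ω, g₂ (W s ω) - 2 * (a' s * F₁ (W s ω) + a s * g₁ (W s ω)) + 2 * a s * a' s ≤
        κ + (n : ℝ) ^ 2 * ∑ i ∈ Finset.range m,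
          (‖powTrace (i + 1) (W s ω : Matrix (Fin N) (Fin N) ℂ) - limitMoment s (i + 1)‖ ^ 2 +
            ‖powTrace (m - i) (W s ω : Matrix (Fin N) (Fin N) ℂ) - limitMoment s (m - i)‖ ^ 2) := by
      intro ω
      have h := drift_le (x := fun k => powTrace k (W s ω : Matrix (Fin N) (Fin N) ℂ))
        (a := limitMoment s) (powTrace_zero hN _) (if_pos rfl)
        (fun k => norm_powTrace_le_one k _) (abs_limitMoment_le_one s.2) m
      have e : g₂ (W s ω) - 2 * (a' s * F₁ (W s ω) + a s * g₁ (W s ω)) + 2 * a s * a' s =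
          κ + 2 * (((starRingEnd ℂ) (powTrace n (W s ω : Matrix (Fin N) (Fin N) ℂ)) - a s) *
            ((1 / 2) * powTraceLaplacian n (W s ω : Matrix (Fin N) (Fin N) ℂ) - (a' s : ℂ))).re := by
        simp only [g₂, F₁, g₁]
        generalize powTrace n (W s ω : Matrix (Fin N) (Fin N) ℂ) = z
        generalize powTraceLaplacian n (W s ω : Matrix (Fin N) (Fin N) ℂ) = w
        have h12 : (1 / 2 : ℂ) = ((1 / 2 : ℝ) : ℂ) := by push_cast; rfl
        rw [h12]
        simp only [Complex.mul_re, Complex.sub_re, Complex.sub_im, Complex.conj_re, Complex.conj_im,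
          Complex.ofReal_re, Complex.ofReal_im, Complex.im_ofReal_mul]
        ring
      rw [e]
      exact add_le_add le_rfl h
    have hint2 : ∀ i ∈ Finset.range m, Integrable (fun ω =>
        ‖powTrace (i + 1) (W s ω : Matrix (Fin N) (Fin N) ℂ) - limitMoment s (i + 1)‖ ^ 2 +
          ‖powTrace (m - i) (W s ω : Matrix (Fin N) (Fin N) ℂ) - limitMoment s (m - i)‖ ^ 2) P :=
      fun i _ => (hint (i + 1) s).add (hint (m - i) s)
    calc D' s ≤ ∫ ω, (κ + (n : ℝ) ^ 2 * ∑ i ∈ Finset.range m,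
          (‖powTrace (i + 1) (W s ω : Matrix (Fin N) (Fin N) ℂ) - limitMoment s (i + 1)‖ ^ 2 +
            ‖powTrace (m - i) (W s ω : Matrix (Fin N) (Fin N) ℂ) -
              limitMoment s (m - i)‖ ^ 2)) ∂P := by
          rw [hD'eq]
          refine integral_mono ?_ ?_ hpt
          · exact (j2.sub (((i1.const_mul _).add (j1.const_mul _)).const_mul 2)).add
              (integrable_const _)
          · exact (integrable_const _).add ((integrable_finsetSum _ hint2).const_mul _)
      _ = κ + (n : ℝ) ^ 2 * ∑ i ∈ Finset.range m,
          (∫ ω, ‖powTrace (i + 1) (W s ω : Matrix (Fin N) (Fin N) ℂ) -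
              limitMoment s (i + 1)‖ ^ 2 ∂P +
            ∫ ω, ‖powTrace (m - i) (W s ω : Matrix (Fin N) (Fin N) ℂ) -
              limitMoment s (m - i)‖ ^ 2 ∂P) := by
          rw [integral_add (integrable_const _) ((integrable_finsetSum _ hint2).const_mul _),
            integral_const, probReal_univ, one_smul, integral_const_mul,
            integral_finsetSum _ hint2]
          congr 2
          exact Finset.sum_congr rfl fun i _ => integral_add (hint (i + 1) s) (hint (m - i) s)
      _ ≤ κ + (n : ℝ) ^ 2 * ∑ i ∈ Finset.range m,
          (c (i + 1) / (N : ℝ) ^ 2 + c (m - i) / (N : ℝ) ^ 2) := by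
          gcongr with i hi
          · have := Finset.mem_range.1 hi
            exact hc _ (by omega) s hsT
          · exact hc _ (by omega) s hsT
      _ = K := by
          simp only [← add_div]
          rw [← Finset.sum_div, hK, hκ]
          ring
  have hD0 : D 0 = 0 := by
    have hF1 : F₁ 1 = 1 := by
      change (powTrace n _).re = 1
      rw [powTrace_one hN, Complex.one_re]
    have hF2 : F₂ 1 = 1 := by
      change Complex.normSq (powTrace n _) = 1
      rw [powTrace_one hN, map_one]
    simp only [D, B₁, B₂, a, intervalIntegral.integral_same, hF1, hF2, limitMoment_zero_left]
    norm_num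
  rw [hDeq]
  refine image_le_of_deriv_right_le_deriv_boundary (a := 0) (b := (t : ℝ)) (f := D) (f' := D')
    (B := fun s => K * s) (B' := fun _ => K) (fun s _ => (hD s).continuousAt.continuousWithinAt)
    (fun s _ => (hD s).hasDerivWithinAt) (by simp [hD0]) (by fun_prop)
    (fun s _ => by simpa using ((hasDerivAt_id s).const_mul K).hasDerivWithinAt)
    (fun s hs => hD'le s hs.1 (hs.2.le.trans ht)) ⟨t.2, le_rfl⟩

/-- The traces of powers of unitary Brownian motion concentrate: their mean square distance from
the limiting moments is `O(1 / N²)`. -/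
lemma exists_integral_sq_le (n : ℕ) (T : ℝ) :
    ∃ c : ℝ, ∀ (N : ℕ) (_ : N ≠ 0) (U : ℝ≥0 → Ω → Matrix.unitaryGroup (Fin N) ℂ),
      IsUnitaryBrownianMotion N U P → ∀ t : ℝ≥0, (t : ℝ) ≤ T →
        ∫ ω, ‖powTrace n (U t ω : Matrix (Fin N) (Fin N) ℂ) - limitMoment t n‖ ^ 2 ∂P ≤
          c / (N : ℝ) ^ 2 := by
  induction n using Nat.strong_induction_on with
  | _ n ih =>
    rcases n with _ | m
    · refine ⟨0, fun N hN U _ t _ => ?_⟩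
      have h0 : limitMoment t 0 = 1 := if_pos rfl
      simp [powTrace_zero hN, h0]
    · choose! c hc using ih
      set K := ((m + 1 : ℕ) : ℝ) ^ 2 * (1 + ∑ i ∈ Finset.range m, (c (i + 1) + c (m - i))) with hK
      refine ⟨|K| * |T|, fun N hN U hU t ht => ?_⟩
      refine (hU.integral_sq_le hN m (fun k hk t ht => hc k (by omega) N hN U hU t ht) t ht).trans ?_
      rw [← hK, div_mul_eq_mul_div]
      gcongr
      · exact le_abs_self K
      · exact ht.trans (le_abs_self T)

end Variance

/-! ### Almost sure convergence of the spectral measures -/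

lemma ae_tendsto_powTrace {Ω : Type*} [MeasurableSpace Ω] {P : Measure Ω} [IsProbabilityMeasure P]
    {U : (N : ℕ) → ℝ≥0 → Ω → Matrix.unitaryGroup (Fin N) ℂ}
    (hU : ∀ N, 1 ≤ N → IsUnitaryBrownianMotion N (U N) P) (t : ℝ≥0) (n : ℕ) :
    ∀ᵐ ω ∂P, Tendsto (fun N => powTrace n (U (N + 1) t ω : Matrix (Fin (N + 1)) (Fin (N + 1)) ℂ))
      atTop (𝓝 (limitMoment t n : ℂ)) := by
  obtain ⟨c, hc⟩ := exists_integral_sq_le (P := P) n (t : ℝ)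
  let Y : ℕ → Ω → ℝ := fun N ω =>
    ‖powTrace n (U (N + 1) t ω : Matrix (Fin (N + 1)) (Fin (N + 1)) ℂ) - limitMoment t n‖ ^ 2
  have hYm : ∀ N, StronglyMeasurable (Y N) := by
    intro N
    obtain ⟨ℱ, hadp, -⟩ := (hU (N + 1) (by omega)).martingale_problem
    have h : Continuous fun V : Matrix.unitaryGroup (Fin (N + 1)) ℂ =>
        ‖powTrace n (V : Matrix (Fin (N + 1)) (Fin (N + 1)) ℂ) - limitMoment t n‖ ^ 2 :=
      ((continuous_powTrace n).sub continuous_const).norm.pow 2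
    exact h.comp_stronglyMeasurable ((hadp t).mono (ℱ.le t))
  have hYi : ∀ N, Integrable (Y N) P := by
    intro N
    refine Integrable.of_bound (hYm N).aestronglyMeasurable ((1 + 1) ^ 2) (ae_of_all _ fun ω => ?_)
    rw [Real.norm_of_nonneg (by positivity)]
    have h := norm_sub_le (powTrace n (U (N + 1) t ω : Matrix (Fin (N + 1)) (Fin (N + 1)) ℂ))
      (limitMoment t n : ℂ)
    rw [Complex.norm_real, Real.norm_eq_abs] at h
    change ‖_‖ ^ 2 ≤ _
    gcongr
    exact h.trans (add_le_add (norm_powTrace_le_one n _) (abs_limitMoment_le_one t.2 n))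
  have hsum : Summable fun N : ℕ => c / ((N + 1 : ℕ) : ℝ) ^ 2 := by
    have h := (summable_nat_add_iff 1).2 (Real.summable_one_div_nat_pow.2 (by norm_num : 1 < 2))
    simpa only [mul_one_div] using h.mul_left c
  have hlint : ∑' N, ∫⁻ ω, ENNReal.ofReal (Y N ω) ∂P ≠ ∞ := by
    have h1 : ∀ N, ∫⁻ ω, ENNReal.ofReal (Y N ω) ∂P ≤
        ENNReal.ofReal (c / ((N + 1 : ℕ) : ℝ) ^ 2) := by
      intro N
      rw [← ofReal_integral_eq_lintegral_ofReal (hYi N) (ae_of_all _ fun ω => by positivity)]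
      exact ENNReal.ofReal_le_ofReal
        (hc (N + 1) (by omega) (U (N + 1)) (hU (N + 1) (by omega)) t le_rfl)
    exact ((ENNReal.tsum_le_tsum h1).trans_lt hsum.tsum_ofReal_lt_top).ne
  rw [← lintegral_tsum fun N => (hYm N).measurable.ennreal_ofReal.aemeasurable] at hlint
  have hfin := ae_lt_top (Measurable.tsum
    fun N => (hYm N).measurable.ennreal_ofReal) hlint
  filter_upwards [hfin] with ω hω
  have h0 := ENNReal.tendsto_atTop_zero_of_tsum_ne_top hω.ne
  have h1 : Tendsto (fun N => Y N ω) atTop (𝓝 0) := by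
    have h2 := (ENNReal.tendsto_toReal ENNReal.zero_ne_top).comp h0
    refine (h2.congr fun N => ?_).trans (by simp)
    exact ENNReal.toReal_ofReal (by positivity)
  have h3 := (Real.continuous_sqrt.tendsto 0).comp h1
  rw [Real.sqrt_zero] at h3
  rw [tendsto_iff_norm_sub_tendsto_zero]
  exact h3.congr fun N => Real.sqrt_sq (norm_nonneg _)

lemma isLimitingSpectralMeasure_of_moments {t : ℝ≥0} {ν : Measure Circle}
    [hν : IsProbabilityMeasure ν]
    (hm : ∀ n : ℕ, n ≠ 0 → ∫ z, (z : ℂ) ^ n ∂ν = bianeMoment t n) :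
    IsLimitingSpectralMeasure.{u} t ν := by
  refine ⟨hν, fun Ω _ P _ U hU => ?_⟩
  filter_upwards [ae_all_iff.2 fun n => ae_tendsto_powTrace hU t n] with ω hω f
  rw [← tendsto_add_atTop_iff_nat 1]
  have hprob : ∀ N : ℕ, IsProbabilityMeasure (spectralMeasure (U (N + 1) t ω)) :=
    fun N => isProbabilityMeasure_spectralMeasure N.succ_ne_zero _
  refine tendsto_integral_of_tendsto_moments (μ := fun N => spectralMeasure (U (N + 1) t ω))
    (fun n hn => ?_) f
  have h := hω n
  rw [limitMoment, if_neg hn, ← hm n hn] at h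
  refine h.congr fun N => ?_
  rw [integral_pow_spectralMeasure, powTrace]

theorem proposition1p4 :
    ∃ ν : ℝ≥0 → Measure Circle,
      (∀ t : ℝ≥0, 0 < t → IsLimitingSpectralMeasure.{u} t (ν t)) ∧
      ∃ C : ℝ, 0 < C ∧ ∀ t : ℝ≥0, 1 ≤ t →
        wasserstein1 (ν t) uniformCircle ≤
          ENNReal.ofReal (C * (t : ℝ) ^ (3 / 2 : ℝ) * Real.exp (-(t : ℝ) / 4)) := by
  choose ν hν hm hW using fun t : ℝ≥0 => exists_measure_bianeMoment t.2
  refine ⟨ν, fun t _ => ?_, 6, by norm_num, fun t ht => (hW t).trans (ENNReal.ofReal_le_ofReal ?_)⟩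
  · have := hν t
    exact isLimitingSpectralMeasure_of_moments (hm t)
  · have h1 : (1 : ℝ) ≤ (t : ℝ) ^ (3 / 2 : ℝ) :=
      Real.one_le_rpow (by exact_mod_cast ht) (by norm_num)
    have h2 := Real.exp_pos (-(t : ℝ) / 4)
    calc 6 * Real.exp (-(t : ℝ) / 4) ≤ 6 * Real.exp (-(t : ℝ) / 4) * (t : ℝ) ^ (3 / 2 : ℝ) :=
          le_mul_of_one_le_right (by positivity) h1
      _ = _ := by ring
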